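/- An overpartition of $n$ is a partition of $n$ in which the first occurrence of each part size may be overlined. For a partition or overpartition $\pi$ let $l(\pi)$ be its largest part and $\#(\pi)$ its number of parts. Write $(a;b)_\infty=\prod_{i\ge 0}(1-ab^i)$. Let $\overline{N}(m,n)$ be the number of overpartitions of $n$ whose Dyson rank $l(\pi)-\#(\pi)$ equals $m$. Let $\overline{N2}(m,n)$ be the number of overpartitions of $n$ whose $M_2$-rank $\left\lceil l(\pi)/2\right\rceil-\#(\pi)+\#(\pi_o)-\chi(\pi)$ equals $m$, where $\#(\pi_o)$ is the number of odd non-overlined parts of $\pi$, and $\chi(\pi)=1$ if the largest part of $\pi$ is odd and (its first occurrence is) non-overlined, $\chi(\pi)=0$ otherwise. Let $N2(m,n)$ be the number of partitions of $n$ without repeated odd parts whose $M_2$-rank $\left\lceil l(\pi)/2\right\rceil-\#(\pi)$ equals $m$. Define integers $\overline{M}(m,n)$, $\overline{M2}(m,n)$, $M2(m,n)$ (residual crank counts) as the coefficients in the following formal power series in $q$ over $\mathbb{Z}[z,z^{-1}]$: $$\sum_{n\ge 0}\sum_{m\in\mathbb{Z}}\overline{M}(m,n)z^mq^n=\frac{(-q;q)_\infty(q;q)_\infty}{(zq;q)_\infty(z^{-1}q;q)_\infty},$$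 $$\sum_{n\ge 0}\sum_{m\in\mathbb{Z}}\overline{M2}(m,n)z^mq^n=\frac{(-q;q)_\infty(q^2;q^2)_\infty}{(q;q^2)_\infty(zq^2;q^2)_\infty(z^{-1}q^2;q^2)_\infty},$$ $$\sum_{n\ge 0}\sum_{m\in\mathbb{Z}}M2(m,n)z^mq^n=\frac{(-q;q^2)_\infty(q^2;q^2)_\infty}{(zq^2;q^2)_\infty(z^{-1}q^2;q^2)_\infty}.$$ For each of these six functions $F$ let $F_k(n)=\sum_{m\in\mathbb{Z}}m^kF(m,n)$ (a finite sum) denote its $k$-th moment. Then for every integer $k\ge 1$: 1. $M2_{2k}(n)>N2_{2k}(n)$ for $n=2$ and for all $n\ge 4$; 2. $\overline{M}_{2k}(n)>\overline{N}_{2k}(n)$ for all $n\ge 1$; 3. $\overline{M2}_{2k}(n)>\overline{N2}_{2k}(n)$ for $n=2$ and for all $n\ge 4$. -/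

import Mathlib

namespace RankCrankMoments

open LaurentPolynomial

/-! ### Overpartitions and partitions without repeated odd parts -/

/-- An overpartition of `n`: a partition of `n` in which the first occurrence of each part may be
overlined, recorded by the set of those part sizes whose first occurrence is overlined. -/
@[ext]
structure Overpartition (n : ℕ) where
  /-- the underlying partition, overlines being forgotten -/
  toPartition : n.Partition
  /-- the sizes of the overlined parts -/
  overlined : Finset ℕ
  overlined_subset : overlined ⊆ toPartition.parts.toFinset

/-- Overpartitions as dependent pairs. -/
def Overpartition.equivSigma (n : ℕ) :
    Overpartition n ≃ (Σ p : n.Partition, {S : Finset ℕ // S ∈ p.parts.toFinset.powerset}) where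
  toFun π := ⟨π.toPartition, π.overlined, Finset.mem_powerset.2 π.overlined_subset⟩
  invFun x := ⟨x.1, x.2.1, Finset.mem_powerset.1 x.2.2⟩
  left_inv _ := rfl
  right_inv _ := rfl

instance (n : ℕ) : Fintype (Overpartition n) :=
  Fintype.ofEquiv _ (Overpartition.equivSigma n).symm

/-- The largest element of a multiset of natural numbers (`0` for the empty multiset). -/
def largest (s : Multiset ℕ) : ℕ := s.sup

/-- The multiset of non-overlined parts of an overpartition. -/
def Overpartition.nonOverlined {n : ℕ} (π : Overpartition n) : Multiset ℕ :=
  π.toPartition.parts - π.overlined.val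

/-- The Dyson rank of an overpartition: the largest part minus the number of parts. -/
def Overpartition.dysonRank {n : ℕ} (π : Overpartition n) : ℤ :=
  (largest π.toPartition.parts : ℤ) - (π.toPartition.parts.card : ℤ)

/-- `χ(π)`: this is `1` if the largest part is odd and non-overlined, and `0` otherwise. When the
largest part occurs several times, its first occurrence decides whether it is overlined. -/
def Overpartition.chi {n : ℕ} (π : Overpartition n) : ℤ :=
  if Odd (largest π.toPartition.parts) ∧ largest π.toPartition.parts ∉ π.overlined then 1 else 0

/-- The `M₂`-rank of an overpartition: half the largest part, rounded up, minus the number of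
parts, plus the number of odd non-overlined parts, minus `χ(π)`. -/
def Overpartition.m2Rank {n : ℕ} (π : Overpartition n) : ℤ :=
  ⌈(largest π.toPartition.parts : ℚ) / 2⌉ - (π.toPartition.parts.card : ℤ)
    + ((π.nonOverlined.filter (fun i => Odd i)).card : ℤ) - π.chi

/-- A partition has no repeated odd parts. -/
def NoRepeatedOdd {n : ℕ} (p : n.Partition) : Prop :=
  ∀ i ∈ p.parts, Odd i → p.parts.count i = 1

/-- The `M₂`-rank of a partition (without repeated odd parts): half the largest part, rounded up,
minus the number of parts. -/
def m2Rank {n : ℕ} (p : n.Partition) : ℤ :=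
  ⌈(largest p.parts : ℚ) / 2⌉ - (p.parts.card : ℤ)

/-! ### The rank counts -/

/-- The number of overpartitions of `n` with Dyson rank `m`. -/
def NBar (m : ℤ) (n : ℕ) : ℕ :=
  (Finset.univ.filter (fun π : Overpartition n => π.dysonRank = m)).card

/-- The number of overpartitions of `n` with `M₂`-rank `m`. -/
def N2Bar (m : ℤ) (n : ℕ) : ℕ :=
  (Finset.univ.filter (fun π : Overpartition n => π.m2Rank = m)).card

open Classical in
/-- The number of partitions of `n` without repeated odd parts with `M₂`-rank `m`. -/
noncomputable def N2 (m : ℤ) (n : ℕ) : ℕ :=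
  (Finset.univ.filter (fun p : n.Partition => NoRepeatedOdd p ∧ m2Rank p = m)).card

/-! ### The crank counts

They are coefficients of formal power series in `q` over the Laurent polynomials in `z`. -/

/-- Formal power series in `q` with coefficients in `ℤ[z, z⁻¹]`. -/
abbrev QSeries : Type := PowerSeries (LaurentPolynomial ℤ)

/-- The variable `q`. -/
noncomputable def q : QSeries := PowerSeries.X

/-- The element `z ^ i`, for an integer `i`. -/
noncomputable def z (i : ℤ) : QSeries := PowerSeries.C (T i)

/-- The infinite product `(a; b)_∞ = ∏_{i ≥ 0} (1 - a b^i)`, for `b` with zero constant term.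
The factors with `i > n` do not contribute to the coefficient of `q ^ n`; see
`coeff_qPochhammer`. -/
noncomputable def qPochhammer (a b : QSeries) : QSeries :=
  PowerSeries.mk fun n => PowerSeries.coeff n (∏ i ∈ Finset.range (n + 1), (1 - a * b ^ i))

/-- The inverse of a power series with constant term `1`. -/
noncomputable def inv (f : QSeries) : QSeries := PowerSeries.invOfUnit f 1

/-- The crank generating function of overpartitions,
`(-q;q)_∞ (q;q)_∞ / ((zq;q)_∞ (z⁻¹q;q)_∞)`. -/
noncomputable def CBar : QSeries :=
  qPochhammer (-q) q * qPochhammer q q *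
    inv (qPochhammer (z 1 * q) q * qPochhammer (z (-1) * q) q)

/-- The second crank generating function of overpartitions,
`(-q;q)_∞ (q²;q²)_∞ / ((q;q²)_∞ (zq²;q²)_∞ (z⁻¹q²;q²)_∞)`. -/
noncomputable def C2Bar : QSeries :=
  qPochhammer (-q) q * qPochhammer (q ^ 2) (q ^ 2) *
    inv (qPochhammer q (q ^ 2) * qPochhammer (z 1 * q ^ 2) (q ^ 2) *
      qPochhammer (z (-1) * q ^ 2) (q ^ 2))

/-- The crank generating function of partitions without repeated odd parts,
`(-q;q²)_∞ (q²;q²)_∞ / ((zq²;q²)_∞ (z⁻¹q²;q²)_∞)`. -/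
noncomputable def C2 : QSeries :=
  qPochhammer (-q) (q ^ 2) * qPochhammer (q ^ 2) (q ^ 2) *
    inv (qPochhammer (z 1 * q ^ 2) (q ^ 2) * qPochhammer (z (-1) * q ^ 2) (q ^ 2))

/-- The coefficient of `z ^ m * q ^ n`. -/
noncomputable def coeffZQ (f : QSeries) (m : ℤ) (n : ℕ) : ℤ :=
  (PowerSeries.coeff n f).coeff m

/-- The residual crank counts of overpartitions. -/
noncomputable def MBar (m : ℤ) (n : ℕ) : ℤ := coeffZQ CBar m n

/-- The second residual crank counts of overpartitions. -/
noncomputable def M2Bar (m : ℤ) (n : ℕ) : ℤ := coeffZQ C2Bar m n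

/-- The residual crank counts of partitions without repeated odd parts. -/
noncomputable def M2 (m : ℤ) (n : ℕ) : ℤ := coeffZQ C2 m n

/-! ### Moments -/

/-- The `k`-th moment `∑_{m ∈ ℤ} m ^ k * c m n`. The sums used here are finite. -/
noncomputable def moment (c : ℤ → ℕ → ℤ) (k n : ℕ) : ℤ := ∑ᶠ m : ℤ, m ^ k * c m n

/-- The rank moments of overpartitions. -/
noncomputable def NBarMoment (k n : ℕ) : ℤ := moment (fun m n => (NBar m n : ℤ)) k n

/-- The crank moments of overpartitions. -/
noncomputable def MBarMoment (k n : ℕ) : ℤ := moment MBar k n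

/-- The `M₂`-rank moments of overpartitions. -/
noncomputable def N2BarMoment (k n : ℕ) : ℤ := moment (fun m n => (N2Bar m n : ℤ)) k n

/-- The second crank moments of overpartitions. -/
noncomputable def M2BarMoment (k n : ℕ) : ℤ := moment M2Bar k n

/-- The `M₂`-rank moments of partitions without repeated odd parts. -/
noncomputable def N2Moment (k n : ℕ) : ℤ := moment (fun m n => (N2 m n : ℤ)) k n

/-- The crank moments of partitions without repeated odd parts. -/
noncomputable def M2Moment (k n : ℕ) : ℤ := moment M2 k n

/-! ### The definitions are meaningful -/

/-- The coefficients of the finite products stabilise at those of `qPochhammer a b`. -/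
theorem coeff_qPochhammer (a b : QSeries) (hb : PowerSeries.constantCoeff b = 0) (n N : ℕ)
    (hN : n < N) : PowerSeries.coeff n (qPochhammer a b) =
      PowerSeries.coeff n (∏ i ∈ Finset.range N, (1 - a * b ^ i)) := by
  rw [qPochhammer, PowerSeries.coeff_mk]
  induction N, hN using Nat.le_induction with
  | base => rfl
  | succ N hN ih =>
    rw [ih, Finset.prod_range_succ _ N, mul_sub, mul_one, map_sub]
    have hX : (PowerSeries.X : QSeries) ^ N ∣ b ^ N :=
      pow_dvd_pow_of_dvd (PowerSeries.X_dvd_iff.2 hb) N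
    have h := PowerSeries.X_pow_dvd_iff.1
      ((hX.mul_left a).mul_left (∏ i ∈ Finset.range N, (1 - a * b ^ i))) n hN
    rw [h, sub_zero]

theorem constantCoeff_qPochhammer (a b : QSeries) (ha : PowerSeries.constantCoeff a = 0) :
    PowerSeries.constantCoeff (qPochhammer a b) = 1 := by
  rw [← PowerSeries.coeff_zero_eq_constantCoeff_apply, qPochhammer, PowerSeries.coeff_mk]
  simp [ha]

theorem mul_inv_self (f : QSeries) (hf : PowerSeries.constantCoeff f = 1) : f * inv f = 1 :=
  PowerSeries.mul_invOfUnit f 1 (by simpa using hf)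

theorem finite_support_coeffZQ (f : QSeries) (n : ℕ) :
    (Function.support fun m : ℤ => coeffZQ f m n).Finite :=
  (PowerSeries.coeff n f).coeff.hasFiniteSupport

theorem finite_support_card_filter {α : Type} [Fintype α] (r : α → ℤ) :
    (Function.support fun m : ℤ =>
      ((Finset.univ.filter (fun a : α => r a = m)).card : ℤ)).Finite := by
  refine (Set.finite_range r).subset fun m hm => ?_
  obtain ⟨a, ha⟩ := Finset.card_ne_zero.1 (Nat.cast_ne_zero.1 (Function.mem_support.1 hm))
  exact ⟨a, (Finset.mem_filter.1 ha).2⟩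

theorem finite_support_NBar (n : ℕ) : (Function.support fun m : ℤ => (NBar m n : ℤ)).Finite :=
  finite_support_card_filter Overpartition.dysonRank

theorem finite_support_N2Bar (n : ℕ) : (Function.support fun m : ℤ => (N2Bar m n : ℤ)).Finite :=
  finite_support_card_filter Overpartition.m2Rank

theorem finite_support_N2 (n : ℕ) : (Function.support fun m : ℤ => (N2 m n : ℤ)).Finite := by
  classical
  refine (Set.finite_range (m2Rank (n := n))).subset fun m hm => ?_
  obtain ⟨a, ha⟩ := Finset.card_ne_zero.1 (Nat.cast_ne_zero.1 (Function.mem_support.1 hm))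
  exact ⟨a, (Finset.mem_filter.1 ha).2.2⟩

end RankCrankMoments

/-!
Write `y = z + z⁻¹ - 2`. Since `(1 - z Q ^ i) (1 - z⁻¹ Q ^ i) = (1 - Q ^ i) ^ 2 - y Q ^ i`, the
reciprocal of this factor is `(1 - Q ^ i) ^ (-2) D_i` with
`D_i = 1 / (1 - y Q ^ i / (1 - Q ^ i) ^ 2)`, a power series in `y` and `q` with nonnegative
coefficients and constant term `1` (`inv_mul_inv_z`).

Products over `i` start at `i = 1`. Each of the three rank generating functions has the shape
`∑ n, κ_n / ((z Q; Q)_n (z⁻¹ Q; Q)_n) = ∑ n, E_n D_1 ⋯ D_n`, where `Q` is `q` or `q ^ 2`, and `κ_n`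
(`rankCoeff`) and hence `E_n` are free of `z` and have nonnegative coefficients. At `z = 1` all
`D_i` are `1`, so that `∑ n, E_n` counts all objects; the crank generating function is
this count times `∏ i, D_i`. Hence the crank minus the rank generating function is
`∑ n, E_n (∏ i, D_i - ∏ i ≤ n, D_i)`, which has nonnegative coefficients in `y` and `q`
(`sub_congMod_crankRankDiff`). The even moments of `y ^ j` are nonnegative, and those of `y` of
positive order are `2` (`laurentMoment_nonneg`, `laurentMoment_yVar`), so it is enough to find the
monomial `y q ^ n` in the difference: the summand `n = 0` contributes `y Q ^ a` for `a ≥ 1`, and for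
`Q = q ^ 2` the summand `n = 1` contributes `y q Q ^ a` for `a ≥ 2`
(`ySeries_mul_q_pow_posLE_crankRankDiff`).

It remains to obtain the shape of the rank generating functions. Sorting the objects by a level
`L`, the part of the rank that depends only on the largest part, gives `∑ L, z ^ L (B_L - B_{L-1})`,
where `B_L`, the generating function of the objects of level at most `L`, is a finite product
(`levelProd`). A telescoping argument of Rogers–Fine type turns this sum into the sum over `n`
(`fineTerm_telescope`, `levelSum_congMod`). It holds for any pair of mutually inverse series in the
place of `z` and `z⁻¹`, and the pair `1, 1` yields the value of `∑ n, E_n`.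

Infinite sums and products are avoided: all identities are stated modulo powers of `q`, with finite
sums and products.
-/

namespace RankCrankMoments

open LaurentPolynomial

/-! ### Congruences modulo powers of `q` and inverses of power series -/

/-- Congruence of power series modulo `q ^ N`: the coefficients of `q ^ m` agree for `m < N`. -/
def CongMod (N : ℕ) (f g : QSeries) : Prop := (PowerSeries.X : QSeries) ^ N ∣ f - g

namespace CongMod

variable {N : ℕ} {f g h f' g' : QSeries}

theorem coeff_eq (hfg : CongMod N f g) {n : ℕ} (hn : n < N) :
    PowerSeries.coeff n f = PowerSeries.coeff n g := by
  rw [← sub_eq_zero, ← map_sub]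
  exact PowerSeries.X_pow_dvd_iff.1 hfg n hn

theorem of_coeff (H : ∀ n < N, PowerSeries.coeff n f = PowerSeries.coeff n g) :
    CongMod N f g :=
  PowerSeries.X_pow_dvd_iff.2 fun n hn => by rw [map_sub, H n hn, sub_self]

@[refl] theorem refl (N : ℕ) (f : QSeries) : CongMod N f f := by simp [CongMod]

theorem of_eq (hfg : f = g) : CongMod N f g := hfg ▸ refl N f

@[trans] theorem trans (hfg : CongMod N f g) (hgh : CongMod N g h) : CongMod N f h := by
  simpa [CongMod] using dvd_add hfg hgh

theorem mul (hfg : CongMod N f g) (hfg' : CongMod N f' g') : CongMod N (f * f') (g * g') := by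
  have e : f * f' - g * g' = (f - g) * f' + g * (f' - g') := by ring
  rw [CongMod, e]
  exact dvd_add (hfg.mul_right _) (hfg'.mul_left _)

theorem sub (hfg : CongMod N f g) (hfg' : CongMod N f' g') : CongMod N (f - f') (g - g') := by
  have e : f - f' - (g - g') = (f - g) - (f' - g') := by ring
  rw [CongMod, e]
  exact dvd_sub hfg hfg'

end CongMod

theorem inv_mul_self {f : QSeries} (hf : PowerSeries.constantCoeff f = 1) : inv f * f = 1 := by
  rw [mul_comm, mul_inv_self f hf]

theorem eq_inv_of_mul_eq_one {f g : QSeries} (hf : PowerSeries.constantCoeff f = 1)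
    (h : f * g = 1) : g = inv f := by
  calc g = inv f * f * g := by rw [inv_mul_self hf, one_mul]
    _ = inv f := by rw [mul_assoc, h, mul_one]

theorem inv_mul {f g : QSeries} (hf : PowerSeries.constantCoeff f = 1)
    (hg : PowerSeries.constantCoeff g = 1) : inv (f * g) = inv f * inv g := by
  refine (eq_inv_of_mul_eq_one (by simp [hf, hg]) ?_).symm
  linear_combination inv g * g * mul_inv_self f hf + mul_inv_self g hg

theorem inv_one : inv 1 = 1 := (eq_inv_of_mul_eq_one (by simp) (by simp)).symm

theorem inv_prod {ι : Type*} (s : Finset ι) (F : ι → QSeries)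
    (hF : ∀ i ∈ s, PowerSeries.constantCoeff (F i) = 1) :
    inv (∏ i ∈ s, F i) = ∏ i ∈ s, inv (F i) := by
  classical
  induction s using Finset.induction_on with
  | empty => simpa using inv_one
  | insert a s ha ih =>
    have hs : ∀ i ∈ s, PowerSeries.constantCoeff (F i) = 1 :=
      fun i hi => hF i (Finset.mem_insert_of_mem hi)
    rw [Finset.prod_insert ha, Finset.prod_insert ha,
      inv_mul (hF a (Finset.mem_insert_self a s)) ?_, ih hs]
    rw [map_prod]
    exact Finset.prod_eq_one hs

theorem CongMod.inv {N : ℕ} {f g : QSeries} (hf : PowerSeries.constantCoeff f = 1)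
    (hg : PowerSeries.constantCoeff g = 1) (hfg : CongMod N f g) :
    CongMod N (inv f) (inv g) := by
  have e : RankCrankMoments.inv f - RankCrankMoments.inv g =
      -(RankCrankMoments.inv f * RankCrankMoments.inv g) * (f - g) := by
    linear_combination RankCrankMoments.inv g * mul_inv_self f hf -
      RankCrankMoments.inv f * mul_inv_self g hg
  rw [CongMod, e]
  exact Dvd.dvd.mul_left hfg _

theorem constantCoeff_eq_zero_of_dvd {f : QSeries} (hf : (PowerSeries.X : QSeries) ∣ f) :
    PowerSeries.constantCoeff f = 0 := PowerSeries.X_dvd_iff.1 hf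

theorem constantCoeff_one_sub_mul {a b : QSeries} (hb : (PowerSeries.X : QSeries) ∣ b) :
    PowerSeries.constantCoeff (1 - a * b) = 1 := by
  simp [constantCoeff_eq_zero_of_dvd hb]

theorem constantCoeff_one_sub {b : QSeries} (hb : (PowerSeries.X : QSeries) ∣ b) :
    PowerSeries.constantCoeff (1 - b) = 1 := by
  simp [constantCoeff_eq_zero_of_dvd hb]

theorem constantCoeff_one_sub_mul_pow {a b : QSeries} (hb : (PowerSeries.X : QSeries) ∣ b)
    (n : ℕ) : PowerSeries.constantCoeff (1 - a * b ^ (n + 1)) = 1 :=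
  constantCoeff_one_sub_mul (hb.trans (dvd_pow_self b n.succ_ne_zero))

/-! ### A terminating form of the Rogers–Fine transformation -/

section Fine

variable (Z W Q β γ e : QSeries)

/-- The summand of the basic hypergeometric series
`∑ L, (Wβ; Q)_L (Wγ; Q)_L (Z Q ^ j) ^ L / ((eQ; Q)_L (W Q ^ (j + 1); Q)_L)`. -/
noncomputable def fineTerm (j L : ℕ) : QSeries :=
  (Z * Q ^ j) ^ L * ∏ i ∈ Finset.range L, ((1 - W * β * Q ^ i) * (1 - W * γ * Q ^ i) *
    inv (1 - e * Q ^ (i + 1)) * inv (1 - W * Q ^ (j + 1 + i)))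

/-- The factor picked up when `j` is raised by one in the series with summand `fineTerm`. -/
noncomputable def fineFactor (j : ℕ) : QSeries := Q ^ (2 * j + 1) + e - Q ^ j * (β + γ)

variable {Z W Q β γ e}

theorem fineTerm_zero (j : ℕ) : fineTerm Z W Q β γ e j 0 = 1 := by simp [fineTerm]

theorem fineTerm_succ (j L : ℕ) : fineTerm Z W Q β γ e j (L + 1) =
    fineTerm Z W Q β γ e j L * (Z * Q ^ j * ((1 - W * β * Q ^ L) * (1 - W * γ * Q ^ L) *
      inv (1 - e * Q ^ (L + 1)) * inv (1 - W * Q ^ (j + 1 + L)))) := by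
  rw [fineTerm, fineTerm, Finset.prod_range_succ, pow_succ]
  ring

theorem inv_mul_fineTerm_succ (j L : ℕ) :
    inv (1 - W * Q ^ (j + 1)) * fineTerm Z W Q β γ e (j + 1) L =
      Q ^ L * fineTerm Z W Q β γ e j L * inv (1 - W * Q ^ (j + 1 + L)) := by
  induction L with
  | zero => simp [fineTerm_zero]
  | succ L ih =>
    rw [fineTerm_succ, fineTerm_succ, ← mul_assoc, ih,
      show j + 1 + 1 + L = j + 1 + (L + 1) by ring]
    ring

/-- The summands telescope up to passing from `j` to `j + 1`. The condition `Q * e = β * γ` is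
what makes the two terms that are quadratic in `Q ^ L` cancel. -/
theorem fineTerm_telescope (hZW : Z * W = 1) (hQ : (PowerSeries.X : QSeries) ∣ Q)
    (h : Q * e = β * γ) (j L : ℕ) :
    (1 - Z * Q ^ j) * fineTerm Z W Q β γ e j L -
      fineFactor Q β γ e j * (inv (1 - W * Q ^ (j + 1)) * fineTerm Z W Q β γ e (j + 1) L) =
    (1 - e * Q ^ L) * fineTerm Z W Q β γ e j L -
      (1 - e * Q ^ (L + 1)) * fineTerm Z W Q β γ e j (L + 1) := by
  rw [inv_mul_fineTerm_succ, fineTerm_succ]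
  have hu := mul_inv_self (1 - W * Q ^ (j + 1 + L))
    (by rw [show j + 1 + L = j + L + 1 by ring]; exact constantCoeff_one_sub_mul_pow hQ _)
  have hv := mul_inv_self (1 - e * Q ^ (L + 1)) (constantCoeff_one_sub_mul_pow hQ _)
  set u := inv (1 - W * Q ^ (j + 1 + L))
  set v := inv (1 - e * Q ^ (L + 1))
  set F := fineTerm Z W Q β γ e j L
  have key : (1 - Z * Q ^ j) * (1 - W * Q ^ (j + 1 + L)) - fineFactor Q β γ e j * Q ^ L =
      (1 - e * Q ^ L) * (1 - W * Q ^ (j + 1 + L)) -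
        Z * Q ^ j * ((1 - W * β * Q ^ L) * (1 - W * γ * Q ^ L)) := by
    rw [fineFactor]
    simp only [pow_add, pow_mul, pow_one]
    linear_combination (Q ^ j * Q ^ j * Q * Q ^ L - Q ^ j * (β + γ) * Q ^ L +
      Q ^ j * W * β * γ * (Q ^ L) ^ 2) * hZW - W * Q ^ j * (Q ^ L) ^ 2 * h
  linear_combination F * u * key + (Z * Q ^ j * F * (1 - W * β * Q ^ L) * (1 - W * γ * Q ^ L) * u)
    * hv - ((1 - Z * Q ^ j) * F - (1 - e * Q ^ L) * F) * hu

theorem sum_fineTerm (hZW : Z * W = 1) (hQ : (PowerSeries.X : QSeries) ∣ Q)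
    (h : Q * e = β * γ) (j M : ℕ) :
    (1 - Z * Q ^ j) * ∑ L ∈ Finset.range M, fineTerm Z W Q β γ e j L =
      1 - e - (1 - e * Q ^ M) * fineTerm Z W Q β γ e j M + fineFactor Q β γ e j *
        (inv (1 - W * Q ^ (j + 1)) * ∑ L ∈ Finset.range M, fineTerm Z W Q β γ e (j + 1) L) := by
  have := Finset.sum_congr rfl fun L (_ : L ∈ Finset.range M) => fineTerm_telescope hZW hQ h j L
  rw [Finset.sum_range_sub' (fun L => (1 - e * Q ^ L) * fineTerm Z W Q β γ e j L),
    Finset.sum_sub_distrib, ← Finset.mul_sum, ← Finset.mul_sum, ← Finset.mul_sum,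
    fineTerm_zero] at this
  linear_combination this

theorem X_pow_dvd_fineTerm_succ (hQ : (PowerSeries.X : QSeries) ∣ Q) (j M : ℕ) :
    (PowerSeries.X : QSeries) ^ M ∣ fineTerm Z W Q β γ e (j + 1) M := by
  rw [fineTerm]
  refine Dvd.dvd.mul_right (pow_dvd_pow_of_dvd ?_ M) _
  exact (hQ.trans (dvd_pow_self Q j.succ_ne_zero)).mul_left _

variable (Z W Q β γ e)

/-- The coefficient of the rank generating function at the `n`-th pair of products
`1 / ((ZQ; Q)_n (WQ; Q)_n)`. -/
noncomputable def rankCoeff (n : ℕ) : QSeries := ∏ j ∈ Finset.range n, fineFactor Q β γ e j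

/-- The reciprocal of `(ZQ; Q)_n (WQ; Q)_n`. -/
noncomputable def invPair (n : ℕ) : QSeries :=
  ∏ j ∈ Finset.range n, (inv (1 - Z * Q ^ (j + 1)) * inv (1 - W * Q ^ (j + 1)))

/-- The generating function of the objects of level at most `L`, in which `W` marks the parts
that are counted by the rank. -/
noncomputable def levelProd (L : ℕ) : QSeries :=
  inv (1 - e) * ∏ i ∈ Finset.range L, ((1 - W * β * Q ^ i) * (1 - W * γ * Q ^ i) *
    inv (1 - e * Q ^ (i + 1)) * inv (1 - W * Q ^ (i + 1)))

/-- The sum `∑ L, Z ^ L (B_L - B_{L-1})` over the levels `L ≤ M`. -/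
noncomputable def levelSum (B : ℕ → QSeries) (M : ℕ) : QSeries :=
  B 0 + ∑ L ∈ Finset.range M, Z ^ (L + 1) * (B (L + 1) - B L)

variable {Z W Q β γ e}

theorem inv_mul_fineTerm_zero (L : ℕ) :
    inv (1 - e) * fineTerm Z W Q β γ e 0 L = Z ^ L * levelProd W Q β γ e L := by
  rw [fineTerm, levelProd]
  simp only [pow_zero, mul_one, zero_add, Nat.add_comm 1]
  ring

/-- Multiplying `∑ L, Z ^ L (B_L - B_{L-1})` out by partial summation gives `1 - Z` times the
series at `j = 0`, which diverges; the telescoping removes the divergence. -/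
theorem levelSum_eq (hZW : Z * W = 1) (hQ : (PowerSeries.X : QSeries) ∣ Q)
    (h : Q * e = β * γ) (M : ℕ) :
    levelSum Z (levelProd W Q β γ e) M = inv (1 - e) * (1 - e +
      e * Q ^ M * fineTerm Z W Q β γ e 0 M + fineFactor Q β γ e 0 * (inv (1 - W * Q ^ 1) *
        ∑ L ∈ Finset.range M, fineTerm Z W Q β γ e 1 L)) := by
  have h1 : ∀ L ∈ Finset.range M,
      Z ^ (L + 1) * (levelProd W Q β γ e (L + 1) - levelProd W Q β γ e L) =
      inv (1 - e) * (fineTerm Z W Q β γ e 0 (L + 1) - fineTerm Z W Q β γ e 0 L) +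
        inv (1 - e) * ((1 - Z) * fineTerm Z W Q β γ e 0 L) := by
    intro L _
    rw [mul_sub, ← inv_mul_fineTerm_zero (L + 1), pow_succ]
    linear_combination Z * inv_mul_fineTerm_zero (Z := Z) (W := W) (Q := Q) (β := β) (γ := γ)
      (e := e) L
  have h2 := sum_fineTerm (β := β) (γ := γ) (e := e) hZW hQ h 0 M
  have h3 : levelProd W Q β γ e 0 = inv (1 - e) := by simp [levelProd]
  rw [levelSum, Finset.sum_congr rfl h1, Finset.sum_add_distrib, ← Finset.mul_sum,
    ← Finset.mul_sum, Finset.sum_range_sub, ← Finset.mul_sum, fineTerm_zero, h3]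
  simp only [pow_zero, mul_one, zero_add] at h2
  linear_combination inv (1 - e) * h2

theorem rankCoeff_succ (n : ℕ) :
    rankCoeff Q β γ e (n + 1) = rankCoeff Q β γ e n * fineFactor Q β γ e n :=
  Finset.prod_range_succ _ _

theorem invPair_succ (n : ℕ) : invPair Z W Q (n + 1) =
    invPair Z W Q n * (inv (1 - Z * Q ^ (n + 1)) * inv (1 - W * Q ^ (n + 1))) :=
  Finset.prod_range_succ _ _

theorem X_dvd_fineFactor (hQ : (PowerSeries.X : QSeries) ∣ Q) (hβ : (PowerSeries.X : QSeries) ∣ β)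
    (hγ : (PowerSeries.X : QSeries) ∣ γ) (he : (PowerSeries.X : QSeries) ∣ e) (j : ℕ) :
    (PowerSeries.X : QSeries) ∣ fineFactor Q β γ e j :=
  dvd_sub (dvd_add (hQ.trans (dvd_pow_self Q (2 * j).succ_ne_zero)) he)
    ((dvd_add hβ hγ).mul_left _)

theorem X_pow_dvd_rankCoeff (hQ : (PowerSeries.X : QSeries) ∣ Q)
    (hβ : (PowerSeries.X : QSeries) ∣ β) (hγ : (PowerSeries.X : QSeries) ∣ γ)
    (he : (PowerSeries.X : QSeries) ∣ e) (n : ℕ) :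
    (PowerSeries.X : QSeries) ^ n ∣ rankCoeff Q β γ e n := by
  induction n with
  | zero => simp
  | succ n ih =>
    rw [pow_succ, rankCoeff_succ]
    exact mul_dvd_mul ih (X_dvd_fineFactor hQ hβ hγ he n)

/-- The rank generating function, written as a sum over levels, is the series
`∑ n, rankCoeff n / ((ZQ; Q)_n (WQ; Q)_n)`. -/
theorem levelSum_congMod (hZW : Z * W = 1) (hQ : (PowerSeries.X : QSeries) ∣ Q)
    (hβ : (PowerSeries.X : QSeries) ∣ β) (hγ : (PowerSeries.X : QSeries) ∣ γ)
    (he : (PowerSeries.X : QSeries) ∣ e) (h : Q * e = β * γ) (M : ℕ) :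
    CongMod M (levelSum Z (levelProd W Q β γ e) M)
      (∑ n ∈ Finset.range (M + 1), rankCoeff Q β γ e n * invPair Z W Q n) := by
  have hQM : (PowerSeries.X : QSeries) ^ M ∣ Q ^ M := pow_dvd_pow_of_dvd hQ M
  have hinv := inv_mul_self (constantCoeff_one_sub he)
  have step : ∀ m : ℕ, CongMod M (levelSum Z (levelProd W Q β γ e) M)
      (∑ n ∈ Finset.range (m + 1), rankCoeff Q β γ e n * invPair Z W Q n +
        rankCoeff Q β γ e (m + 1) * (invPair Z W Q m * inv (1 - W * Q ^ (m + 1)) *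
          (inv (1 - e) * ∑ L ∈ Finset.range M, fineTerm Z W Q β γ e (m + 1) L))) := by
    intro m
    induction m with
    | zero =>
      have e1 : levelSum Z (levelProd W Q β γ e) M - (∑ n ∈ Finset.range (0 + 1),
          rankCoeff Q β γ e n * invPair Z W Q n + rankCoeff Q β γ e (0 + 1) *
          (invPair Z W Q 0 * inv (1 - W * Q ^ (0 + 1)) *
          (inv (1 - e) * ∑ L ∈ Finset.range M, fineTerm Z W Q β γ e (0 + 1) L))) =
          Q ^ M * (inv (1 - e) * e * fineTerm Z W Q β γ e 0 M) := by
        rw [levelSum_eq hZW hQ h]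
        simp only [rankCoeff, invPair, Finset.sum_range_one, Finset.prod_range_zero,
          Finset.prod_range_one, zero_add]
        linear_combination hinv
      rw [CongMod, e1]
      exact hQM.mul_right _
    | succ m ih =>
      refine ih.trans ?_
      have h2 := sum_fineTerm (β := β) (γ := γ) (e := e) hZW hQ h (m + 1) M
      have h3 := inv_mul_self (constantCoeff_one_sub_mul_pow (a := Z) hQ m)
      rw [Finset.sum_range_succ _ (m + 1), rankCoeff_succ (m + 1), invPair_succ m, CongMod]
      set S := ∑ L ∈ Finset.range M, fineTerm Z W Q β γ e (m + 1) L
      set S' := ∑ L ∈ Finset.range M, fineTerm Z W Q β γ e (m + 1 + 1) L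
      set z' := inv (1 - Z * Q ^ (m + 1))
      set w' := inv (1 - W * Q ^ (m + 1))
      set r := rankCoeff Q β γ e (m + 1)
      set t := fineTerm Z W Q β γ e (m + 1) M with ht
      have e1 : ∀ A : QSeries, A + r * (invPair Z W Q m * w' * (inv (1 - e) * S)) -
          (A + r * (invPair Z W Q m * (z' * w')) + r * fineFactor Q β γ e (m + 1) *
          (invPair Z W Q m * (z' * w') * inv (1 - W * Q ^ (m + 1 + 1)) * (inv (1 - e) * S'))) =
          t * (-(1 - e * Q ^ M) * r * invPair Z W Q m * z' * w' * inv (1 - e)) := by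
        intro A
        linear_combination r * invPair Z W Q m * w' * inv (1 - e) * z' * h2 -
          r * invPair Z W Q m * w' * inv (1 - e) * S * h3 + r * invPair Z W Q m * w' * z' * hinv
      rw [e1]
      exact (X_pow_dvd_fineTerm_succ hQ m M).mul_right _
  refine (step M).trans ?_
  rw [CongMod, add_sub_cancel_left]
  exact ((pow_dvd_pow _ M.le_succ).trans
    (X_pow_dvd_rankCoeff hQ hβ hγ he (M + 1))).mul_right _

end Fine

/-! ### Moments of Laurent polynomials -/

/-- The `k`-th moment `∑ m, m ^ k * p_m` of a Laurent polynomial `∑ m, p_m z ^ m`. -/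
noncomputable def laurentMoment (k : ℕ) : LaurentPolynomial ℤ →+ ℤ where
  toFun p := p.coeff.sum fun m a => m ^ k * a
  map_zero' := by simp
  map_add' p p' := by
    rw [AddMonoidAlgebra.coeff_add]
    exact Finsupp.sum_add_index' (by simp) (by intros; ring)

theorem laurentMoment_T (k : ℕ) (n : ℤ) : laurentMoment k (T n) = n ^ k := by
  change (Finsupp.single n (1 : ℤ)).sum (fun m a => m ^ k * a) = _
  simp

theorem moment_eq_laurentMoment (f : QSeries) (k n : ℕ) :
    moment (coeffZQ f) k n = laurentMoment k (PowerSeries.coeff n f) := by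
  rw [moment, finsum_eq_sum_of_support_subset (s := (PowerSeries.coeff n f).coeff.support)]
  · rfl
  · intro m hm
    simp only [Function.mem_support, coeffZQ] at hm
    simpa using right_ne_zero_of_mul hm

/-- `y = z + z⁻¹ - 2`, which is `(z ^ (1/2) - z ^ (-1/2)) ^ 2`. -/
noncomputable def yVar : LaurentPolynomial ℤ := T 1 + T (-1) - 2

/-- Multiplication by `y` acts on moments as the second difference of `m ↦ m ^ k`, expanded by
the binomial theorem. -/
theorem laurentMoment_yVar_mul (k : ℕ) (p : LaurentPolynomial ℤ) :
    laurentMoment k (yVar * p) =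
      ∑ i ∈ Finset.range k, k.choose i * (1 + (-1) ^ (k - i)) * laurentMoment i p := by
  induction p using LaurentPolynomial.induction_on' with
  | add p p' hp hp' =>
    rw [mul_add, map_add, hp, hp', ← Finset.sum_add_distrib]
    exact Finset.sum_congr rfl fun i _ => by rw [map_add]; ring
  | C_mul_T n a =>
    have hT : yVar * T n = T (n + 1) + T (n + -1) - (2 : ℤ) • T n := by
      rw [yVar, T_add, T_add, zsmul_eq_mul]
      push_cast
      ring
    rw [← smul_eq_C_mul, mul_smul_comm, hT]
    simp only [map_zsmul, map_add, map_sub, laurentMoment_T, smul_eq_mul]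
    rw [add_pow, add_pow, Finset.sum_range_succ, Finset.sum_range_succ]
    simp only [one_pow, mul_one, Nat.choose_self, Nat.cast_one, Nat.sub_self, pow_zero]
    rw [show ∀ A B C : ℤ, A + C + (B + C) - 2 * C = A + B by intros; ring,
      ← Finset.sum_add_distrib, Finset.mul_sum]
    exact Finset.sum_congr rfl fun i _ => by ring

/-- The Laurent polynomials that are polynomials in `y` with nonnegative integer coefficients. -/
noncomputable def yNonneg : Subsemiring (LaurentPolynomial ℤ) :=
  (Polynomial.aeval (R := ℕ) yVar).toRingHom.rangeS

theorem yVar_mem_yNonneg : yVar ∈ yNonneg := ⟨Polynomial.X, by simp⟩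

theorem laurentMoment_yVar_pow_nonneg (j k : ℕ) (hk : Even k) :
    0 ≤ laurentMoment k (yVar ^ j) := by
  induction j generalizing k with
  | zero =>
    rw [pow_zero, ← T_zero, laurentMoment_T]
    exact hk.pow_nonneg _
  | succ j ih =>
    rw [pow_succ', laurentMoment_yVar_mul]
    refine Finset.sum_nonneg fun i hi => ?_
    rcases Nat.even_or_odd i with he | ho
    · rw [(hk.tsub he).neg_one_pow]
      exact mul_nonneg (by positivity) (ih i he)
    · rw [Odd.neg_one_pow (Nat.Even.sub_odd (Finset.mem_range.1 hi).le hk ho)]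
      simp

theorem laurentMoment_nonneg {p : LaurentPolynomial ℤ} (hp : p ∈ yNonneg) {k : ℕ}
    (hk : Even k) : 0 ≤ laurentMoment k p := by
  obtain ⟨P, rfl⟩ := hp
  induction P using Polynomial.induction_on' with
  | add P P' h h' =>
    rw [map_add, map_add]
    exact add_nonneg h h'
  | monomial j a =>
    have : (Polynomial.aeval (R := ℕ) yVar).toRingHom (Polynomial.monomial j a) =
        a • yVar ^ j := by
      simp [nsmul_eq_mul]
    rw [this, map_nsmul]
    exact nsmul_nonneg (laurentMoment_yVar_pow_nonneg j k hk) a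

theorem laurentMoment_yVar {k : ℕ} (hk : Even k) (hk0 : k ≠ 0) : laurentMoment k yVar = 2 := by
  have h2 : yVar = T 1 + T (-1) - (2 : ℤ) • T 0 := by
    rw [yVar, T_zero, zsmul_eq_mul]
    simp
  rw [h2]
  simp only [map_zsmul, map_add, map_sub, laurentMoment_T, one_pow, hk.neg_one_pow, zero_pow hk0]
  norm_num

/-! ### Power series with coefficients that are nonnegative in `y` -/

/-- The power series in `q` all of whose coefficients lie in `yNonneg`. -/
def posSeries : Subsemiring QSeries where
  carrier := {f | ∀ n, PowerSeries.coeff n f ∈ yNonneg}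
  zero_mem' n := by simp
  one_mem' n := by
    rw [PowerSeries.coeff_one]
    split_ifs
    exacts [one_mem _, zero_mem _]
  add_mem' hf hg n := by
    rw [map_add]
    exact add_mem (hf n) (hg n)
  mul_mem' hf hg n := by
    rw [PowerSeries.coeff_mul]
    exact sum_mem fun i _ => mul_mem (hf _) (hg _)

theorem q_mem_posSeries : q ∈ posSeries := fun n => by
  rw [q, PowerSeries.coeff_X]
  split_ifs
  exacts [one_mem _, zero_mem _]

/-- `y` as a constant power series in `q`. -/
noncomputable def ySeries : QSeries := PowerSeries.C yVar

theorem ySeries_mem_posSeries : ySeries ∈ posSeries := fun n => by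
  rw [ySeries, PowerSeries.coeff_C]
  split_ifs
  exacts [yVar_mem_yNonneg, zero_mem _]

theorem inv_one_sub_eq {g : QSeries} (hg0 : (PowerSeries.X : QSeries) ∣ g) :
    inv (1 - g) = 1 + g * inv (1 - g) := by
  linear_combination mul_inv_self (1 - g) (constantCoeff_one_sub hg0)

theorem inv_one_sub_mem_posSeries {g : QSeries} (hg0 : (PowerSeries.X : QSeries) ∣ g)
    (hg : g ∈ posSeries) : inv (1 - g) ∈ posSeries := by
  intro n
  induction n using Nat.strong_induction_on with
  | _ n ih =>
    rw [inv_one_sub_eq hg0, map_add, PowerSeries.coeff_mul]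
    refine add_mem (one_mem posSeries n) (sum_mem fun ij hij => ?_)
    rw [Finset.HasAntidiagonal.mem_antidiagonal] at hij
    rcases Nat.eq_zero_or_pos ij.1 with h0 | h0
    · rw [h0, PowerSeries.coeff_zero_eq_constantCoeff_apply, constantCoeff_eq_zero_of_dvd hg0,
        zero_mul]
      exact zero_mem _
    · exact mul_mem (hg _) (ih _ (by omega))

/-- `f ≼ g` if `g - f` has coefficients that are nonnegative in `y`. -/
def PosLE (f g : QSeries) : Prop := g - f ∈ posSeries

local infix:50 " ≼ " => PosLE

namespace PosLE

variable {f g h : QSeries}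

theorem refl (f : QSeries) : f ≼ f := by simp [PosLE]

theorem trans (hfg : f ≼ g) (hgh : g ≼ h) : f ≼ h := by
  simpa [PosLE] using add_mem hfg hgh

theorem mul_left {a : QSeries} (ha : a ∈ posSeries) (hfg : f ≼ g) : a * f ≼ a * g := by
  rw [PosLE, ← mul_sub]
  exact mul_mem ha hfg

theorem mul_right {a : QSeries} (ha : a ∈ posSeries) (hfg : f ≼ g) : f * a ≼ g * a := by
  rw [PosLE, ← sub_mul]
  exact mul_mem hfg ha

theorem self_mul {a : QSeries} (hf : f ∈ posSeries) (ha : 1 ≼ a) : f ≼ f * a := by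
  simpa using mul_left hf ha

theorem mem (hf : f ∈ posSeries) (hfg : f ≼ g) : g ∈ posSeries := by
  simpa using add_mem hf hfg

theorem sum {ι : Type*} {s : Finset ι} {F : ι → QSeries} (H : ∀ i ∈ s, F i ∈ posSeries) {i : ι}
    (hi : i ∈ s) (hf : f ≼ F i) : f ≼ ∑ i ∈ s, F i := by
  classical
  refine hf.trans ?_
  rw [PosLE, ← Finset.sum_erase_eq_sub hi]
  exact sum_mem fun j hj => H j (Finset.mem_of_mem_erase hj)

end PosLE

theorem one_posLE_inv_one_sub {g : QSeries} (hg0 : (PowerSeries.X : QSeries) ∣ g)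
    (hg : g ∈ posSeries) : 1 ≼ inv (1 - g) := by
  rw [PosLE, inv_one_sub_eq hg0, add_sub_cancel_left]
  exact mul_mem hg (inv_one_sub_mem_posSeries hg0 hg)

theorem pow_posLE_inv_one_sub {g : QSeries} (hg0 : (PowerSeries.X : QSeries) ∣ g)
    (hg : g ∈ posSeries) (n : ℕ) : g ^ n ≼ inv (1 - g) := by
  induction n with
  | zero => simpa using one_posLE_inv_one_sub hg0 hg
  | succ n ih =>
    have h1 : inv (1 - g) - g ^ (n + 1) = 1 + g * (inv (1 - g) - g ^ n) := by
      rw [pow_succ]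
      linear_combination inv_one_sub_eq hg0
    rw [PosLE, h1]
    exact add_mem (one_mem _) (mul_mem hg ih)

/-! ### The crank and the rank as products over `1 - y Q ^ i / (1 - Q ^ i) ^ 2` -/

section Compare

variable (Q : QSeries)

/-- `Q ^ (i + 1) / (1 - Q ^ (i + 1)) ^ 2`. -/
noncomputable def uTerm (i : ℕ) : QSeries := Q ^ (i + 1) * inv (1 - Q ^ (i + 1)) ^ 2

/-- `1 / (1 - y Q ^ (i + 1) / (1 - Q ^ (i + 1)) ^ 2)`. -/
noncomputable def dFactor (i : ℕ) : QSeries := inv (1 - ySeries * uTerm Q i)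

variable {Q}

theorem X_dvd_pow_succ (hQ : (PowerSeries.X : QSeries) ∣ Q) (i : ℕ) :
    (PowerSeries.X : QSeries) ∣ Q ^ (i + 1) := hQ.trans (dvd_pow_self Q i.succ_ne_zero)

theorem X_dvd_ySeries_mul_uTerm (hQ : (PowerSeries.X : QSeries) ∣ Q) (i : ℕ) :
    (PowerSeries.X : QSeries) ∣ ySeries * uTerm Q i :=
  ((X_dvd_pow_succ hQ i).mul_right _).mul_left _

theorem uTerm_mem_posSeries (hQ : (PowerSeries.X : QSeries) ∣ Q) (hQp : Q ∈ posSeries) (i : ℕ) :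
    uTerm Q i ∈ posSeries :=
  mul_mem (pow_mem hQp _)
    (pow_mem (inv_one_sub_mem_posSeries (X_dvd_pow_succ hQ i) (pow_mem hQp _)) 2)

theorem z_mul_z_neg : z 1 * z (-1) = 1 := by
  rw [z, z, ← map_mul, ← T_add]
  simp

theorem ySeries_eq : ySeries = z 1 + z (-1) - 2 := by
  rw [ySeries, yVar, z, z, map_sub, map_add, map_ofNat]

theorem inv_mul_inv_z (hQ : (PowerSeries.X : QSeries) ∣ Q) (i : ℕ) :
    inv (1 - z 1 * Q ^ (i + 1)) * inv (1 - z (-1) * Q ^ (i + 1)) =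
      inv (1 - Q ^ (i + 1)) ^ 2 * dFactor Q i := by
  have h1 := constantCoeff_one_sub_mul_pow (a := z 1) hQ i
  have h2 := constantCoeff_one_sub_mul_pow (a := z (-1)) hQ i
  have h3 := mul_inv_self _ (constantCoeff_one_sub (X_dvd_pow_succ hQ i))
  have h4 := mul_inv_self _ (constantCoeff_one_sub (X_dvd_ySeries_mul_uTerm hQ i))
  rw [← inv_mul h1 h2]
  refine (eq_inv_of_mul_eq_one (by rw [map_mul, h1, h2, one_mul]) ?_).symm
  rw [dFactor]
  rw [uTerm, ySeries_eq] at h4 ⊢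
  set v := inv (1 - Q ^ (i + 1))
  set d := inv (1 - (z 1 + z (-1) - 2) * (Q ^ (i + 1) * v ^ 2))
  linear_combination h4 + v ^ 2 * d * (Q ^ (i + 1)) ^ 2 * z_mul_z_neg +
    d * ((1 - Q ^ (i + 1)) * v + 1) * h3

theorem dFactor_mem_posSeries (hQ : (PowerSeries.X : QSeries) ∣ Q) (hQp : Q ∈ posSeries) (i : ℕ) :
    dFactor Q i ∈ posSeries :=
  inv_one_sub_mem_posSeries (X_dvd_ySeries_mul_uTerm hQ i)
    (mul_mem ySeries_mem_posSeries (uTerm_mem_posSeries hQ hQp i))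

theorem one_posLE_dFactor (hQ : (PowerSeries.X : QSeries) ∣ Q) (hQp : Q ∈ posSeries) (i : ℕ) :
    1 ≼ dFactor Q i :=
  one_posLE_inv_one_sub (X_dvd_ySeries_mul_uTerm hQ i)
    (mul_mem ySeries_mem_posSeries (uTerm_mem_posSeries hQ hQp i))

theorem prod_dFactor_mem_posSeries (hQ : (PowerSeries.X : QSeries) ∣ Q) (hQp : Q ∈ posSeries)
    (n : ℕ) : ∏ i ∈ Finset.range n, dFactor Q i ∈ posSeries :=
  prod_mem fun i _ => dFactor_mem_posSeries hQ hQp i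

theorem prod_dFactor_mono (hQ : (PowerSeries.X : QSeries) ∣ Q) (hQp : Q ∈ posSeries) {n m : ℕ}
    (hnm : n ≤ m) : ∏ i ∈ Finset.range n, dFactor Q i ≼ ∏ i ∈ Finset.range m, dFactor Q i := by
  induction m, hnm using Nat.le_induction with
  | base => exact PosLE.refl _
  | succ m _ ih =>
    rw [Finset.prod_range_succ]
    exact ih.trans (PosLE.self_mul (prod_dFactor_mem_posSeries hQ hQp m)
      (one_posLE_dFactor hQ hQp m))

/-- The term of degree one in `y` of the `n`-th factor survives in the difference. -/
theorem ySeries_mul_uTerm_posLE (hQ : (PowerSeries.X : QSeries) ∣ Q) (hQp : Q ∈ posSeries)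
    {n m : ℕ} (hnm : n < m) : ySeries * uTerm Q n ≼
      ∏ i ∈ Finset.range m, dFactor Q i - ∏ i ∈ Finset.range n, dFactor Q i := by
  have hyu := mul_mem ySeries_mem_posSeries (uTerm_mem_posSeries hQ hQp n)
  have h1 : ySeries * uTerm Q n ≼ (∏ i ∈ Finset.range n, dFactor Q i) * (dFactor Q n - 1) := by
    have h2 : dFactor Q n - 1 = ySeries * uTerm Q n * dFactor Q n := by
      have := inv_one_sub_eq (X_dvd_ySeries_mul_uTerm hQ n)
      rw [dFactor]
      linear_combination this
    rw [h2, mul_comm (∏ i ∈ Finset.range n, dFactor Q i)]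
    refine (PosLE.self_mul hyu (one_posLE_dFactor hQ hQp n)).trans
      (PosLE.self_mul (mul_mem hyu (dFactor_mem_posSeries hQ hQp n)) ?_)
    simpa using prod_dFactor_mono hQ hQp (Nat.zero_le n)
  refine h1.trans ?_
  have h3 := prod_dFactor_mono hQ hQp (Nat.succ_le_of_lt hnm)
  rw [Finset.prod_range_succ] at h3
  simpa [PosLE, mul_sub] using h3

variable (Q) (β γ e : QSeries)

/-- The difference of the crank and the rank generating functions, truncated: the rank series is
`∑ n, E_n ∏_{i < n} D_i` and the crank series is `(∑ n, E_n) ∏_i D_i`. -/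
noncomputable def crankRankDiff (M : ℕ) : QSeries :=
  ∑ n ∈ Finset.range (M + 1), rankCoeff Q β γ e n *
    (∏ i ∈ Finset.range n, inv (1 - Q ^ (i + 1)) ^ 2) *
    (∏ i ∈ Finset.range M, dFactor Q i - ∏ i ∈ Finset.range n, dFactor Q i)

variable {Q β γ e}

theorem rankCoeff_mem_posSeries (hQp : Q ∈ posSeries) (hβ : -β ∈ posSeries) (hγ : -γ ∈ posSeries)
    (he : e ∈ posSeries) (n : ℕ) : rankCoeff Q β γ e n ∈ posSeries := by
  refine prod_mem fun j _ => ?_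
  rw [fineFactor, show Q ^ (2 * j + 1) + e - Q ^ j * (β + γ) =
    Q ^ (2 * j + 1) + e + Q ^ j * (-β + -γ) by ring]
  exact add_mem (add_mem (pow_mem hQp _) he) (mul_mem (pow_mem hQp _) (add_mem hβ hγ))

/-- A single summand of the difference, estimated from below by its part that is linear
in `y`. -/
theorem posLE_crankRankDiff (hQ : (PowerSeries.X : QSeries) ∣ Q) (hQp : Q ∈ posSeries)
    (hβ : -β ∈ posSeries) (hγ : -γ ∈ posSeries) (he : e ∈ posSeries) {n M : ℕ} (hn : n < M) :
    rankCoeff Q β γ e n * (∏ i ∈ Finset.range n, inv (1 - Q ^ (i + 1)) ^ 2) *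
      (ySeries * uTerm Q n) ≼ crankRankDiff Q β γ e M := by
  have hpre : ∀ m, rankCoeff Q β γ e m *
      (∏ i ∈ Finset.range m, inv (1 - Q ^ (i + 1)) ^ 2) ∈ posSeries := fun m =>
    mul_mem (rankCoeff_mem_posSeries hQp hβ hγ he m) (prod_mem fun i _ => pow_mem
      (inv_one_sub_mem_posSeries (X_dvd_pow_succ hQ i) (pow_mem hQp _)) 2)
  refine PosLE.sum (i := n) (fun m hm => mul_mem (hpre m) ?_) (Finset.mem_range.2 (by omega))
    (PosLE.mul_left (hpre n) (ySeries_mul_uTerm_posLE hQ hQp hn))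
  exact prod_dFactor_mono hQ hQp (Nat.lt_succ_iff.1 (Finset.mem_range.1 hm))

theorem pow_posLE_uTerm (hQ : (PowerSeries.X : QSeries) ∣ Q) (hQp : Q ∈ posSeries) (a : ℕ) :
    Q ^ (a + 1) ≼ uTerm Q 0 := by
  have hv := pow_posLE_inv_one_sub hQ hQp
  rw [uTerm, zero_add, pow_one, pow_succ', sq]
  refine PosLE.mul_left hQp ((hv a).trans (PosLE.self_mul (PosLE.mem (pow_mem hQp a) (hv a)) ?_))
  simpa using hv 0

theorem ySeries_mul_pow_posLE_crankRankDiff (hQ : (PowerSeries.X : QSeries) ∣ Q)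
    (hQp : Q ∈ posSeries) (hβ : -β ∈ posSeries) (hγ : -γ ∈ posSeries) (he : e ∈ posSeries)
    (a : ℕ) {M : ℕ} (hM : 0 < M) : ySeries * Q ^ (a + 1) ≼ crankRankDiff Q β γ e M := by
  have h := posLE_crankRankDiff hQ hQp hβ hγ he hM
  rw [rankCoeff, Finset.prod_range_zero, Finset.prod_range_zero, one_mul, one_mul] at h
  exact (PosLE.mul_left ySeries_mem_posSeries (pow_posLE_uTerm hQ hQp a)).trans h

/-- If `-β` contains `q` (so that the numerator at `n = 1` does), the summand at `n = 1`
contributes `y q Q ^ (a + 2)`. -/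
theorem ySeries_mul_q_mul_pow_posLE_crankRankDiff (hQ : (PowerSeries.X : QSeries) ∣ Q)
    (hQp : Q ∈ posSeries) (hβ : -β ∈ posSeries) (hγ : -γ ∈ posSeries) (he : e ∈ posSeries)
    (hq : q ≼ -β) (a : ℕ) {M : ℕ} (hM : 1 < M) :
    ySeries * (q * Q ^ (a + 2)) ≼ crankRankDiff Q β γ e M := by
  have h := posLE_crankRankDiff hQ hQp hβ hγ he hM
  refine PosLE.trans ?_ h
  have hv := pow_posLE_inv_one_sub hQ hQp
  have hvp := inv_one_sub_mem_posSeries hQ hQp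
  have h1v := one_posLE_inv_one_sub hQ hQp
  have hκ : q ≼ rankCoeff Q β γ e 1 := by
    refine hq.trans ?_
    rw [PosLE, rankCoeff, Finset.prod_range_one, fineFactor,
      show Q ^ (2 * 0 + 1) + e - Q ^ 0 * (β + γ) - -β = Q + e + -γ by ring]
    exact add_mem (add_mem hQp he) hγ
  have hκp := rankCoeff_mem_posSeries (e := e) hQp hβ hγ he 1
  have hprod : Q ^ a ≼ ∏ i ∈ Finset.range 1, inv (1 - Q ^ (i + 1)) ^ 2 := by
    rw [Finset.prod_range_one, zero_add, pow_one, sq]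
    exact (hv a).trans (PosLE.self_mul hvp h1v)
  have hu : Q ^ 2 ≼ uTerm Q 1 := by
    have h1w := one_posLE_inv_one_sub (X_dvd_pow_succ hQ 1) (pow_mem hQp (1 + 1))
    have hwp := inv_one_sub_mem_posSeries (X_dvd_pow_succ hQ 1) (pow_mem hQp (1 + 1))
    rw [uTerm]
    refine PosLE.self_mul (pow_mem hQp 2) ?_
    rw [sq]
    exact h1w.trans (PosLE.self_mul hwp h1w)
  have hyp := ySeries_mem_posSeries
  rw [show ySeries * (q * Q ^ (a + 2)) = q * Q ^ a * (ySeries * Q ^ 2) by ring]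
  have hκV : q * Q ^ a ≼ rankCoeff Q β γ e 1 * ∏ i ∈ Finset.range 1, inv (1 - Q ^ (i + 1)) ^ 2 :=
    (PosLE.mul_right (pow_mem hQp a) hκ).trans (PosLE.mul_left hκp hprod)
  exact (PosLE.mul_right (mul_mem hyp (pow_mem hQp 2)) hκV).trans
    (PosLE.mul_left (PosLE.mem (mul_mem q_mem_posSeries (pow_mem hQp a)) hκV)
      (PosLE.mul_left hyp hu))

/-- A series that exceeds `y q ^ n` has a positive even moment at `q ^ n`. -/
theorem laurentMoment_coeff_pos {f : QSeries} {n k : ℕ} (h : ySeries * q ^ n ≼ f)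
    (hk : Even k) (hk0 : k ≠ 0) : 0 < laurentMoment k (PowerSeries.coeff n f) := by
  have h1 := laurentMoment_nonneg (h n) hk
  have h2 : PowerSeries.coeff n (ySeries * q ^ n) = yVar := by
    rw [ySeries, q, PowerSeries.coeff_C_mul, PowerSeries.coeff_X_pow_self, mul_one]
  rw [map_sub, h2, map_sub, laurentMoment_yVar hk hk0] at h1
  linarith

/-- The comparison of crank and rank: both the crank and the rank series reduce to the data
`levelProd`, the first one through its value at `z = 1`. -/
theorem sub_congMod_crankRankDiff (hQ : (PowerSeries.X : QSeries) ∣ Q)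
    (hβ : (PowerSeries.X : QSeries) ∣ β) (hγ : (PowerSeries.X : QSeries) ∣ γ)
    (he : (PowerSeries.X : QSeries) ∣ e) (h : Q * e = β * γ) {F R : QSeries} {M : ℕ}
    (hF : CongMod M F (levelProd 1 Q β γ e M * (∏ i ∈ Finset.range M, (1 - Q ^ (i + 1)) ^ 2) *
      invPair (z 1) (z (-1)) Q M))
    (hR : CongMod M R (levelSum (z 1) (levelProd (z (-1)) Q β γ e) M)) :
    CongMod M (F - R) (crankRankDiff Q β γ e M) := by
  have hpair : ∀ n, invPair (z 1) (z (-1)) Q n = (∏ i ∈ Finset.range n,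
      inv (1 - Q ^ (i + 1)) ^ 2) * ∏ i ∈ Finset.range n, dFactor Q i := by
    intro n
    rw [invPair, ← Finset.prod_mul_distrib]
    exact Finset.prod_congr rfl fun i _ => inv_mul_inv_z hQ i
  have hcancel : (∏ i ∈ Finset.range M, (1 - Q ^ (i + 1)) ^ 2) * invPair (z 1) (z (-1)) Q M =
      ∏ i ∈ Finset.range M, dFactor Q i := by
    rw [hpair, ← mul_assoc, ← Finset.prod_mul_distrib, Finset.prod_eq_one, one_mul]
    intro i _
    rw [← mul_pow, mul_inv_self _ (constantCoeff_one_sub (X_dvd_pow_succ hQ i)), one_pow]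
  -- At `z = 1` the sum over levels telescopes to `levelProd`.
  have hone : CongMod M (levelProd 1 Q β γ e M) (∑ n ∈ Finset.range (M + 1),
      rankCoeff Q β γ e n * ∏ i ∈ Finset.range n, inv (1 - Q ^ (i + 1)) ^ 2) := by
    have h1 := levelSum_congMod (one_mul 1) hQ hβ hγ he h M
    simp only [levelSum, one_pow, one_mul, Finset.sum_range_sub, add_sub_cancel] at h1
    simpa [invPair, sq] using h1
  have hF' := hF.trans (CongMod.of_eq (mul_assoc _ _ _))
  rw [hcancel] at hF'
  refine ((hF'.trans (hone.mul (CongMod.refl _ _))).sub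
    (hR.trans (levelSum_congMod z_mul_z_neg hQ hβ hγ he h M))).trans (CongMod.of_eq ?_)
  rw [crankRankDiff, Finset.sum_mul, ← Finset.sum_sub_distrib]
  exact Finset.sum_congr rfl fun n _ => by rw [hpair]; ring

end Compare

/-! ### Generating functions of partitions and overpartitions with bounded parts -/

open scoped PowerSeries.WithPiTopology in
/-- The generating function of partitions into parts of size at most `M`, in which a part of size
`i` contributes `x i`, and its first occurrence either `x i` or `y i`. -/
theorem coeff_prod_range_eq_sum_partition (x y : ℕ → LaurentPolynomial ℤ) (M n : ℕ) :
    PowerSeries.coeff n (∏ i ∈ Finset.range M, ((1 + PowerSeries.C (y (i + 1)) * q ^ (i + 1)) *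
      inv (1 - PowerSeries.C (x (i + 1)) * q ^ (i + 1)))) =
    ∑ p : n.Partition, if ∀ i ∈ p.parts.toFinset, i ≤ M then
      ∏ i ∈ p.parts.toFinset, (y i * x i ^ (p.parts.count i - 1) + x i ^ p.parts.count i)
      else 0 := by
  classical
  let _ : TopologicalSpace (LaurentPolynomial ℤ) := ⊥
  have : DiscreteTopology (LaurentPolynomial ℤ) := ⟨rfl⟩
  let f : ℕ → ℕ → LaurentPolynomial ℤ := fun i c =>
    if i ≤ M then y i * x i ^ (c - 1) + x i ^ c else 0
  have hqX : (PowerSeries.X : QSeries) ∣ q := dvd_rfl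
  have hfactor : ∀ i < M, (1 + ∑' j, f (i + 1) (j + 1) • (PowerSeries.X : QSeries) ^
      ((i + 1) * (j + 1))) = (1 + PowerSeries.C (y (i + 1)) * q ^ (i + 1)) *
      inv (1 - PowerSeries.C (x (i + 1)) * q ^ (i + 1)) := by
    intro i hi
    set g : QSeries := PowerSeries.C (x (i + 1)) * q ^ (i + 1) with hg
    have hg0 : PowerSeries.constantCoeff g = 0 :=
      constantCoeff_eq_zero_of_dvd ((X_dvd_pow_succ hqX i).mul_left _)
    have hterm : ∀ j, f (i + 1) (j + 1) • (PowerSeries.X : QSeries) ^ ((i + 1) * (j + 1)) =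
        (PowerSeries.C (y (i + 1)) * q ^ (i + 1) + g) * g ^ j := by
      intro j
      simp only [f, if_pos (Nat.succ_le_of_lt hi), hg, PowerSeries.smul_eq_C_mul, q, map_add,
        map_mul, map_pow, Nat.add_sub_cancel]
      ring
    have hgeom : ∑' j, g ^ j = inv (1 - g) :=
      eq_inv_of_mul_eq_one (by simp [hg0])
        (PowerSeries.WithPiTopology.one_sub_mul_tsum_pow_of_constantCoeff_eq_zero hg0)
    rw [tsum_congr hterm, (PowerSeries.WithPiTopology.summable_pow_of_constantCoeff_eq_zero
      hg0).tsum_mul_left, hgeom]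
    linear_combination -mul_inv_self (1 - g) (by simp [hg0])
  have hprod := Nat.Partition.hasProd_genFun f
  have hone : ∀ i ∉ Finset.range M, (1 + ∑' j, f (i + 1) (j + 1) • (PowerSeries.X : QSeries) ^
      ((i + 1) * (j + 1))) = 1 := by
    intro i hi
    rw [Finset.mem_range, not_lt] at hi
    simp [f, show ¬ i + 1 ≤ M by omega]
  have heq := (hasProd_prod_of_ne_finset_one hone).unique hprod
  rw [Finset.prod_congr rfl fun i hi => hfactor i (Finset.mem_range.1 hi)] at heq
  rw [heq, Nat.Partition.coeff_genFun]
  refine Finset.sum_congr rfl fun p _ => ?_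
  rw [Finsupp.prod, Multiset.toFinsupp_support]
  simp only [f, Multiset.toFinsupp_apply]
  rw [Finset.prod_ite_zero]

/-- The product of the weights of the parts of an overpartition: `y i` for an overlined and `x i`
for a non-overlined part of size `i`. -/
noncomputable def Overpartition.weight (x y : ℕ → LaurentPolynomial ℤ) {n : ℕ}
    (π : Overpartition n) : LaurentPolynomial ℤ :=
  (∏ i ∈ π.overlined, y i) * (π.nonOverlined.map x).prod

theorem Overpartition.overlined_val_le {n : ℕ} (π : Overpartition n) :
    π.overlined.val ≤ π.toPartition.parts :=
  (Finset.val_le_iff_val_subset.2 π.overlined_subset).trans (Multiset.dedup_le _)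

theorem Overpartition.overlined_add_nonOverlined {n : ℕ} (π : Overpartition n) :
    π.overlined.val + π.nonOverlined = π.toPartition.parts :=
  add_tsub_cancel_of_le π.overlined_val_le

theorem Overpartition.weight_eq (x y : ℕ → LaurentPolynomial ℤ) {n : ℕ} (π : Overpartition n) :
    π.weight x y = (∏ i ∈ π.overlined, y i * x i ^ (π.toPartition.parts.count i - 1)) *
      ∏ i ∈ π.toPartition.parts.toFinset \ π.overlined, x i ^ π.toPartition.parts.count i := by
  have hsub : π.nonOverlined.toFinset ⊆ π.toPartition.parts.toFinset :=
    Multiset.toFinset_subset.2 (Multiset.subset_of_le (Multiset.sub_le_self _ _))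
  rw [weight, Finset.prod_multiset_map_count, Finset.prod_subset hsub (fun i _ hi => by
    rw [Multiset.count_eq_zero_of_notMem (by simpa using hi), pow_zero]),
    Finset.prod_mul_distrib, mul_assoc, ← Finset.prod_sdiff π.overlined_subset,
    mul_comm (∏ i ∈ _ \ _, _)]
  congr 2
  · refine Finset.prod_congr rfl fun i hi => ?_
    rw [nonOverlined, Multiset.count_sub, Multiset.count_eq_one_of_mem π.overlined.nodup hi]
  · refine Finset.prod_congr rfl fun i hi => ?_
    rw [nonOverlined, Multiset.count_sub,
      Multiset.count_eq_zero_of_notMem (Finset.mem_sdiff.1 hi).2, Nat.sub_zero]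

theorem sum_overpartition {n : ℕ} {R : Type*} [AddCommMonoid R]
    (F : (p : n.Partition) → Finset ℕ → R) :
    ∑ π : Overpartition n, F π.toPartition π.overlined =
      ∑ p : n.Partition, ∑ S ∈ p.parts.toFinset.powerset, F p S := by
  have h : ∑ π : Overpartition n, F π.toPartition π.overlined =
      ∑ s : (Σ p : n.Partition, {S : Finset ℕ // S ∈ p.parts.toFinset.powerset}), F s.1 s.2.1 :=
    Fintype.sum_equiv (Overpartition.equivSigma n) _ _ fun _ => rfl
  rw [h, Fintype.sum_sigma]
  exact Finset.sum_congr rfl fun p _ => Finset.sum_coe_sort p.parts.toFinset.powerset (F p)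

/-- The generating function of overpartitions into parts of size at most `M`. -/
theorem coeff_prod_range_eq_sum_overpartition (x y : ℕ → LaurentPolynomial ℤ) (M n : ℕ) :
    PowerSeries.coeff n (∏ i ∈ Finset.range M, ((1 + PowerSeries.C (y (i + 1)) * q ^ (i + 1)) *
      inv (1 - PowerSeries.C (x (i + 1)) * q ^ (i + 1)))) =
    ∑ π : Overpartition n, if ∀ i ∈ π.toPartition.parts, i ≤ M then π.weight x y else 0 := by
  simp only [Overpartition.weight_eq]
  rw [coeff_prod_range_eq_sum_partition, sum_overpartition (fun p S =>
    if ∀ i ∈ p.parts, i ≤ M then (∏ i ∈ S, y i * x i ^ (p.parts.count i - 1)) *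
      ∏ i ∈ p.parts.toFinset \ S, x i ^ p.parts.count i else 0)]
  refine Finset.sum_congr rfl fun p _ => ?_
  simp only [Multiset.mem_toFinset]
  split_ifs
  · exact Finset.prod_add _ _ _
  · simp

theorem prod_map_T (s : Multiset ℕ) (a : ℕ → ℤ) :
    (s.map fun i => (T (a i) : LaurentPolynomial ℤ)).prod = T (s.map a).sum := by
  induction s using Multiset.induction_on with
  | empty => simp
  | cons i s ih => rw [Multiset.map_cons, Multiset.prod_cons, ih, Multiset.map_cons,
      Multiset.sum_cons, T_add]

theorem Overpartition.weight_T (a b : ℕ → ℤ) {n : ℕ} (π : Overpartition n) :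
    π.weight (fun i => T (a i)) (fun i => T (b i)) =
      T ((π.overlined.val.map b).sum + (π.nonOverlined.map a).sum) := by
  rw [T_add, ← prod_map_T, ← prod_map_T]
  rfl

/-! ### Rank generating functions as sums over levels -/

/-- Summation by parts over the values of a level function. -/
theorem sum_T_mul_eq_levels {α : Type*} [Fintype α] (lev : α → ℕ) (wt : α → LaurentPolynomial ℤ)
    {M : ℕ} (hM : ∀ a, lev a ≤ M) :
    ∑ a, T (lev a) * wt a = (∑ a, if lev a ≤ 0 then wt a else 0) +
      ∑ L ∈ Finset.range M, T ((L + 1 : ℕ) : ℤ) *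
        ((∑ a, if lev a ≤ L + 1 then wt a else 0) - ∑ a, if lev a ≤ L then wt a else 0) := by
  have h : ∀ a, T (lev a) * wt a = (if lev a ≤ 0 then wt a else 0) +
      ∑ L ∈ Finset.range M, T ((L + 1 : ℕ) : ℤ) *
        ((if lev a ≤ L + 1 then wt a else 0) - if lev a ≤ L then wt a else 0) := by
    intro a
    rcases Nat.eq_zero_or_pos (lev a) with h0 | h0
    · simp [h0]
    · rw [if_neg (by omega), zero_add, Finset.sum_eq_single (lev a - 1)]
      · rw [if_pos (by omega), if_neg (by omega), Nat.sub_add_cancel h0, sub_zero]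
      · intro L _ hL
        by_cases h1 : lev a ≤ L
        · rw [if_pos h1, if_pos (by omega), sub_self, mul_zero]
        · rw [if_neg h1, if_neg (by omega), sub_self, mul_zero]
      · intro h1
        have := hM a
        rw [Finset.mem_range] at h1
        omega
  rw [Finset.sum_congr rfl fun a _ => h a, Finset.sum_add_distrib, Finset.sum_comm]
  congr 1
  refine Finset.sum_congr rfl fun L _ => ?_
  rw [← Finset.mul_sum, Finset.sum_sub_distrib]

theorem coeff_levelSum (B : ℕ → QSeries) (M n : ℕ) :
    PowerSeries.coeff n (levelSum (z 1) B M) = PowerSeries.coeff n (B 0) +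
      ∑ L ∈ Finset.range M, T ((L + 1 : ℕ) : ℤ) *
        (PowerSeries.coeff n (B (L + 1)) - PowerSeries.coeff n (B L)) := by
  rw [levelSum, map_add, map_sum]
  congr 1
  refine Finset.sum_congr rfl fun L _ => ?_
  rw [z, ← map_pow, T_pow, mul_one, PowerSeries.coeff_C_mul, map_sub]

/-- If `B L` is the generating function of the objects of level at most `L`, then the sum over
levels is the generating function of all objects, with `z` marking the level. -/
theorem congMod_levelSum {α : ℕ → Type*} [∀ n, Fintype (α n)] (lev : ∀ n, α n → ℕ)
    (wt : ∀ n, α n → LaurentPolynomial ℤ) (hlev : ∀ n a, lev n a ≤ n) {B : ℕ → QSeries}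
    (hB : ∀ L n, PowerSeries.coeff n (B L) = ∑ a, if lev n a ≤ L then wt n a else 0) (M : ℕ) :
    CongMod M (PowerSeries.mk fun n => ∑ a, T (lev n a) * wt n a) (levelSum (z 1) B M) := by
  refine CongMod.of_coeff fun n hn => ?_
  rw [PowerSeries.coeff_mk, coeff_levelSum,
    sum_T_mul_eq_levels (lev n) (wt n) fun a => (hlev n a).trans hn.le]
  simp only [hB]

theorem largest_le_iff (s : Multiset ℕ) (L : ℕ) : largest s ≤ L ↔ ∀ i ∈ s, i ≤ L :=
  Multiset.sup_le

theorem largest_le {n : ℕ} (p : n.Partition) : largest p.parts ≤ n :=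
  (largest_le_iff _ _).2 fun _ hi => p.le_of_mem_parts hi

theorem ceil_half (l : ℕ) : ⌈(l : ℚ) / 2⌉ = (((l + 1) / 2 : ℕ) : ℤ) := by
  rw [Int.ceil_eq_iff]
  rcases Nat.even_or_odd' l with ⟨c, rfl | rfl⟩
  · rw [show (2 * c + 1) / 2 = c by omega]
    push_cast
    constructor <;> linarith
  · rw [show (2 * c + 1 + 1) / 2 = c + 1 by omega]
    push_cast
    constructor <;> linarith

/-- The generating function `∑ π, z ^ (rank π) q ^ |π|` of overpartitions, by Dyson rank. -/
noncomputable def dysonRankSeries : QSeries :=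
  PowerSeries.mk fun n => ∑ π : Overpartition n, T π.dysonRank

/-- The generating function of overpartitions by `M₂`-rank. -/
noncomputable def m2RankOverSeries : QSeries :=
  PowerSeries.mk fun n => ∑ π : Overpartition n, T π.m2Rank

open Classical in
/-- The generating function of partitions without repeated odd parts by `M₂`-rank. -/
noncomputable def m2RankSeries : QSeries :=
  PowerSeries.mk fun n => ∑ p : n.Partition with NoRepeatedOdd p, T (m2Rank p)

theorem dysonRankSeries_congMod (M : ℕ) :
    CongMod M dysonRankSeries (levelSum (z 1) (levelProd (z (-1)) q (-q) 0 0) M) := by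
  have h := congMod_levelSum (α := Overpartition) (fun n π => largest π.toPartition.parts)
    (fun _ π => π.weight (fun _ => T (-1)) (fun _ => T (-1))) (fun _ π => largest_le π.toPartition)
    (B := levelProd (z (-1)) q (-q) 0 0) ?_ M
  · convert h using 1
    rw [dysonRankSeries]
    congr 1
    ext n : 1
    refine Finset.sum_congr rfl fun π _ => ?_
    rw [Overpartition.weight_T (fun _ => -1) (fun _ => -1), ← T_add, ← Multiset.sum_add,
      ← Multiset.map_add, π.overlined_add_nonOverlined, Overpartition.dysonRank]
    simp [sub_eq_add_neg]
  · intro L n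
    simp only [largest_le_iff]
    refine Eq.trans ?_ (coeff_prod_range_eq_sum_overpartition
      (fun _ => T (-1)) (fun _ => T (-1)) L n)
    simp only [levelProd, zero_mul, mul_zero, sub_zero, inv_one, one_mul, mul_one, z]
    refine congrArg _ (Finset.prod_congr rfl fun i _ => ?_)
    ring

theorem m2RankSeries_congMod (M : ℕ) :
    CongMod M m2RankSeries (levelSum (z 1) (levelProd (z (-1)) (q ^ 2) (-q) 0 0) M) := by
  classical
  let x : ℕ → LaurentPolynomial ℤ := fun i => if Odd i then 0 else T (-1)
  let y : ℕ → LaurentPolynomial ℤ := fun i => if Odd i then T (-1) else 0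
  have hwt : ∀ {n : ℕ} (p : n.Partition), ∏ i ∈ p.parts.toFinset,
      (y i * x i ^ (p.parts.count i - 1) + x i ^ p.parts.count i) =
      if NoRepeatedOdd p then T (-(p.parts.card : ℤ)) else 0 := by
    intro n p
    have h1 : ∀ i ∈ p.parts.toFinset,
        y i * x i ^ (p.parts.count i - 1) + x i ^ p.parts.count i =
        if Odd i → p.parts.count i = 1 then T (-1) ^ p.parts.count i else 0 := by
      intro i hi
      have hc : p.parts.count i ≠ 0 := Multiset.count_ne_zero.2 (Multiset.mem_toFinset.1 hi)
      by_cases ho : Odd i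
      · by_cases h1 : p.parts.count i = 1
        · simp [x, y, ho, h1]
        · simp [x, y, ho, h1, hc, show p.parts.count i - 1 ≠ 0 by omega]
      · simp [x, y, ho]
    rw [Finset.prod_congr rfl h1, Finset.prod_ite_zero]
    simp only [NoRepeatedOdd, Multiset.mem_toFinset]
    congr 1
    rw [Finset.prod_pow_eq_pow_sum, Multiset.toFinset_sum_count_eq, T_pow]
    simp
  have h := congMod_levelSum (α := Nat.Partition) (fun _ p => (largest p.parts + 1) / 2)
    (fun _ p => if NoRepeatedOdd p then T (-(p.parts.card : ℤ)) else 0)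
    (fun _ p => by have := largest_le p; omega)
    (B := levelProd (z (-1)) (q ^ 2) (-q) 0 0) ?_ M
  · convert h using 1
    rw [m2RankSeries]
    congr 1
    ext n : 1
    rw [Finset.sum_filter]
    refine Finset.sum_congr rfl fun p _ => ?_
    split_ifs
    · rw [← T_add, m2Rank, ceil_half, sub_eq_add_neg]
    · simp
  · intro L n
    have h2 : ∀ p : n.Partition, (largest p.parts + 1) / 2 ≤ L ↔
        ∀ i ∈ p.parts.toFinset, i ≤ 2 * L := by
      intro p
      simp only [Multiset.mem_toFinset]
      rw [← largest_le_iff]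
      omega
    simp only [h2, ← hwt]
    rw [← coeff_prod_range_eq_sum_partition]
    congr 1
    simp only [levelProd, zero_mul, mul_zero, sub_zero, inv_one, one_mul, mul_one]
    clear h2
    induction L with
    | zero => simp
    | succ L ih =>
      rw [mul_add, mul_one, Finset.prod_range_succ, Finset.prod_range_succ,
        Finset.prod_range_succ, ih]
      have ho : Odd (2 * L + 1) := ⟨L, rfl⟩
      have he : ¬ Odd (2 * L + 1 + 1) := by rw [Nat.not_odd_iff_even]; exact ⟨L + 1, by ring⟩
      simp only [x, y, if_pos ho, if_neg he, map_zero, zero_mul, sub_zero, inv_one, add_zero,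
        one_mul, mul_one, z]
      rw [show (q ^ 2) ^ (L + 1) = q ^ (2 * L + 1 + 1) by ring]
      ring

/-- The level of an overpartition for the `M₂`-rank: half the largest part, rounded up, minus
`χ`. -/
def Overpartition.m2Level {n : ℕ} (π : Overpartition n) : ℕ :=
  if Odd (largest π.toPartition.parts) ∧ largest π.toPartition.parts ∉ π.overlined then
    largest π.toPartition.parts / 2 else (largest π.toPartition.parts + 1) / 2

theorem Overpartition.mem_parts_of_mem_overlined {n : ℕ} (π : Overpartition n) {i : ℕ}
    (hi : i ∈ π.overlined) : i ∈ π.toPartition.parts :=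
  Multiset.mem_toFinset.1 (π.overlined_subset hi)

theorem Overpartition.m2Level_le_iff {n : ℕ} (π : Overpartition n) (L : ℕ) :
    π.m2Level ≤ L ↔ (∀ i ∈ π.toPartition.parts, i ≤ 2 * L + 1) ∧ 2 * L + 1 ∉ π.overlined := by
  have hle : ∀ i ∈ π.overlined, i ≤ largest π.toPartition.parts := fun i hi =>
    (largest_le_iff _ _).1 le_rfl i (π.mem_parts_of_mem_overlined hi)
  rw [← largest_le_iff, m2Level]
  split_ifs with h
  · constructor
    · intro h1
      refine ⟨by omega, fun h2 => ?_⟩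
      have h3 := hle _ h2
      have h4 : largest π.toPartition.parts = 2 * L + 1 := by omega
      exact h.2 (h4 ▸ h2)
    · intro h1
      omega
  · constructor
    · intro h1
      refine ⟨by omega, fun h2 => ?_⟩
      have h3 := hle _ h2
      omega
    · rintro ⟨h1, h2⟩
      by_contra h3
      have h4 : largest π.toPartition.parts = 2 * L + 1 := by omega
      exact h (by rw [h4]; exact ⟨⟨L, rfl⟩, h2⟩)

theorem Overpartition.m2Rank_eq {n : ℕ} (π : Overpartition n) :
    π.m2Rank = π.m2Level + ((π.overlined.val.map fun _ => (-1 : ℤ)).sum +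
      (π.nonOverlined.map fun i => if Odd i then (0 : ℤ) else -1).sum) := by
  have h1 : (π.nonOverlined.map fun i => if Odd i then (0 : ℤ) else -1).sum =
      ((π.nonOverlined.filter fun i => Odd i).card : ℤ) - (π.nonOverlined.card : ℤ) := by
    induction π.nonOverlined using Multiset.induction_on with
    | empty => simp
    | cons i s ih =>
      rw [Multiset.map_cons, Multiset.sum_cons, ih]
      by_cases ho : Odd i
      · simp [ho]
      · simp [ho]
        ring
  have h2 : (π.toPartition.parts.card : ℤ) = π.overlined.val.card + π.nonOverlined.card := by
    rw [← Nat.cast_add, ← Multiset.card_add, π.overlined_add_nonOverlined]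
  have h3 : (π.m2Level : ℤ) = ⌈(largest π.toPartition.parts : ℚ) / 2⌉ - π.chi := by
    rw [ceil_half, m2Level, chi]
    split_ifs with h
    · have := h.1
      rw [Nat.odd_iff] at this
      omega
    · simp
  rw [m2Rank, h1, h2, h3]
  simp
  ring

theorem m2RankOverSeries_congMod (M : ℕ) :
    CongMod M m2RankOverSeries
      (levelSum (z 1) (levelProd (z (-1)) (q ^ 2) (-q) (-q ^ 2) q) M) := by
  let a : ℕ → ℤ := fun i => if Odd i then 0 else -1
  have h := congMod_levelSum (α := Overpartition) (fun _ π => π.m2Level)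
    (fun _ π => π.weight (fun i => T (a i)) (fun _ => T (-1)))
    (fun n π => by
      have := largest_le π.toPartition
      rw [Overpartition.m2Level]
      split_ifs <;> omega)
    (B := levelProd (z (-1)) (q ^ 2) (-q) (-q ^ 2) q) ?_ M
  · convert h using 1
    rw [m2RankOverSeries]
    congr 1
    ext n : 1
    refine Finset.sum_congr rfl fun π _ => ?_
    rw [Overpartition.weight_T a (fun _ => -1), ← T_add, π.m2Rank_eq]
  · intro L n
    -- The largest admissible part `2 * L + 1` may not be overlined.
    let y : ℕ → LaurentPolynomial ℤ := fun i => if i = 2 * L + 1 then 0 else T (-1)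
    have hy : ∀ π : Overpartition n,
        (if π.m2Level ≤ L then π.weight (fun i => T (a i)) (fun _ => T (-1)) else 0) =
        if ∀ i ∈ π.toPartition.parts, i ≤ 2 * L + 1 then π.weight (fun i => T (a i)) y else 0 := by
      intro π
      simp only [π.m2Level_le_iff]
      by_cases h1 : ∀ i ∈ π.toPartition.parts, i ≤ 2 * L + 1
      · by_cases h2 : 2 * L + 1 ∈ π.overlined
        · rw [if_neg (fun h => h.2 h2), if_pos h1, Overpartition.weight,
            Finset.prod_eq_zero h2 (by simp [y]), zero_mul]
        · rw [if_pos ⟨h1, h2⟩, if_pos h1, Overpartition.weight, Overpartition.weight]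
          congr 1
          refine Finset.prod_congr rfl fun i hi => ?_
          rw [show y i = T (-1) from if_neg (by rintro rfl; exact h2 hi)]
      · rw [if_neg (fun h => h1 h.1), if_neg h1]
    simp only [hy]
    rw [← coeff_prod_range_eq_sum_overpartition]
    congr 1
    have key : ∀ L' ≤ L, (∏ i ∈ Finset.range (2 * L'), ((1 + PowerSeries.C (y (i + 1)) *
        q ^ (i + 1)) * inv (1 - PowerSeries.C (T (a (i + 1))) * q ^ (i + 1)))) *
        inv (1 - q ^ (2 * L' + 1)) = levelProd (z (-1)) (q ^ 2) (-q) (-q ^ 2) q L' := by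
      intro L' hL'
      induction L' with
      | zero => simp [levelProd]
      | succ L' ih =>
        have ih' := ih (by omega)
        rw [levelProd] at ih' ⊢
        rw [mul_add, mul_one, Finset.prod_range_succ, Finset.prod_range_succ,
          Finset.prod_range_succ]
        have ho : a (2 * L' + 1) = 0 := if_pos ⟨L', rfl⟩
        have he : a (2 * L' + 1 + 1) = -1 :=
          if_neg (by rw [Nat.not_odd_iff_even]; exact ⟨L' + 1, by ring⟩)
        have hy1 : y (2 * L' + 1) = T (-1) := if_neg (by omega)
        have hy2 : y (2 * L' + 1 + 1) = T (-1) := if_neg (by omega)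
        rw [ho, he, hy1, hy2, T_zero, map_one, one_mul,
          show (q ^ 2) ^ (L' + 1) = q ^ (2 * L' + 1 + 1) by ring,
          show q * q ^ (2 * L' + 1 + 1) = q ^ (2 * L' + 2 + 1) by ring,
          show (q ^ 2) ^ L' = q ^ (2 * L') by ring, ← mul_assoc (inv (1 - q)), ← ih', z]
        ring
    rw [Finset.prod_range_succ, ← key L le_rfl]
    have ho : a (2 * L + 1) = 0 := if_pos ⟨L, rfl⟩
    have hy1 : y (2 * L + 1) = 0 := if_pos rfl
    rw [ho, hy1, T_zero, map_one, one_mul, map_zero, zero_mul, add_zero, one_mul]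

/-! ### Crank generating functions modulo powers of `q` -/

theorem qPochhammer_congMod {a b : QSeries} (hb : (PowerSeries.X : QSeries) ∣ b) {M N : ℕ}
    (h : M ≤ N) : CongMod M (qPochhammer a b) (∏ i ∈ Finset.range N, (1 - a * b ^ i)) :=
  CongMod.of_coeff fun n hn =>
    coeff_qPochhammer a b (constantCoeff_eq_zero_of_dvd hb) n N (hn.trans_le h)

/-- The form in which `qPochhammer_congMod` is applied to denominators. -/
theorem inv_qPochhammer_congMod {a b : QSeries} (ha : (PowerSeries.X : QSeries) ∣ a)
    (hb : (PowerSeries.X : QSeries) ∣ b) {M N : ℕ} (h : M ≤ N) :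
    CongMod M (inv (qPochhammer a b)) (∏ i ∈ Finset.range N, inv (1 - a * b ^ i)) := by
  have h1 : ∀ i, PowerSeries.constantCoeff (1 - a * b ^ i) = 1 :=
    fun i => constantCoeff_one_sub (ha.mul_right _)
  rw [← inv_prod _ _ fun i _ => h1 i]
  refine CongMod.inv (constantCoeff_qPochhammer a b (constantCoeff_eq_zero_of_dvd ha)) ?_
    (qPochhammer_congMod hb h)
  rw [map_prod]
  exact Finset.prod_eq_one fun i _ => h1 i

theorem inv_qPochhammer_pair_congMod {Q : QSeries} (hQ : (PowerSeries.X : QSeries) ∣ Q) (M : ℕ) :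
    CongMod M (inv (qPochhammer (z 1 * Q) Q * qPochhammer (z (-1) * Q) Q))
      (invPair (z 1) (z (-1)) Q M) := by
  have hz : ∀ i, (PowerSeries.X : QSeries) ∣ z i * Q := fun i => hQ.mul_left _
  have hc : ∀ i, PowerSeries.constantCoeff (qPochhammer (z i * Q) Q) = 1 := fun i =>
    constantCoeff_qPochhammer _ _ (constantCoeff_eq_zero_of_dvd (hz i))
  rw [inv_mul (hc 1) (hc (-1))]
  refine ((inv_qPochhammer_congMod (hz 1) hQ le_rfl).mul
    (inv_qPochhammer_congMod (hz (-1)) hQ le_rfl)).trans (CongMod.of_eq ?_)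
  rw [invPair, ← Finset.prod_mul_distrib]
  exact Finset.prod_congr rfl fun i _ => by rw [pow_succ', mul_assoc, mul_assoc]

/-- `(Q; Q)_∞` cancels one of the two factors `(Q; Q)_∞` that normalise the crank product. -/
theorem prod_inv_mul_prod_sq {Q : QSeries} (hQ : (PowerSeries.X : QSeries) ∣ Q) (M : ℕ) :
    (∏ i ∈ Finset.range M, inv (1 - Q ^ (i + 1))) *
      ∏ i ∈ Finset.range M, (1 - Q ^ (i + 1)) ^ 2 = ∏ i ∈ Finset.range M, (1 - Q * Q ^ i) := by
  rw [← Finset.prod_mul_distrib]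
  refine Finset.prod_congr rfl fun i _ => ?_
  rw [← pow_succ', sq, ← mul_assoc, inv_mul_self (constantCoeff_one_sub (X_dvd_pow_succ hQ i)),
    one_mul]

theorem X_dvd_q : (PowerSeries.X : QSeries) ∣ q := dvd_rfl

theorem X_dvd_q_sq : (PowerSeries.X : QSeries) ∣ q ^ 2 := dvd_pow_self _ two_ne_zero

/-- The crank series with numerator `(-q; Q)_∞ (Q; Q)_∞`. -/
theorem crank_congMod {Q : QSeries} (hQ : (PowerSeries.X : QSeries) ∣ Q) (M : ℕ) :
    CongMod M (qPochhammer (-q) Q * qPochhammer Q Q *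
      inv (qPochhammer (z 1 * Q) Q * qPochhammer (z (-1) * Q) Q))
      (levelProd 1 Q (-q) 0 0 M * (∏ i ∈ Finset.range M, (1 - Q ^ (i + 1)) ^ 2) *
        invPair (z 1) (z (-1)) Q M) := by
  refine (((qPochhammer_congMod hQ le_rfl).mul (qPochhammer_congMod hQ le_rfl)).mul
    (inv_qPochhammer_pair_congMod hQ M)).trans (CongMod.of_eq ?_)
  rw [← prod_inv_mul_prod_sq hQ]
  simp only [levelProd, zero_mul, mul_zero, sub_zero, inv_one, one_mul, mul_one,
    Finset.prod_mul_distrib]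
  ring

theorem CBar_congMod (M : ℕ) : CongMod M CBar (levelProd 1 q (-q) 0 0 M *
    (∏ i ∈ Finset.range M, (1 - q ^ (i + 1)) ^ 2) * invPair (z 1) (z (-1)) q M) :=
  crank_congMod X_dvd_q M

theorem C2_congMod (M : ℕ) : CongMod M C2 (levelProd 1 (q ^ 2) (-q) 0 0 M *
    (∏ i ∈ Finset.range M, (1 - (q ^ 2) ^ (i + 1)) ^ 2) * invPair (z 1) (z (-1)) (q ^ 2) M) :=
  crank_congMod X_dvd_q_sq M

theorem C2Bar_congMod (M : ℕ) : CongMod M C2Bar (levelProd 1 (q ^ 2) (-q) (-q ^ 2) q M *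
    (∏ i ∈ Finset.range M, (1 - (q ^ 2) ^ (i + 1)) ^ 2) * invPair (z 1) (z (-1)) (q ^ 2) M) := by
  have hc : ∀ a : QSeries, PowerSeries.constantCoeff (qPochhammer (a * q ^ 2) (q ^ 2)) = 1 :=
    fun a => constantCoeff_qPochhammer _ _ (constantCoeff_eq_zero_of_dvd (X_dvd_q_sq.mul_left _))
  rw [C2Bar, mul_assoc (qPochhammer q (q ^ 2)), inv_mul (constantCoeff_qPochhammer _ _
    (constantCoeff_eq_zero_of_dvd X_dvd_q)) (by rw [map_mul, hc, hc, one_mul]), ← mul_assoc]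
  refine ((((qPochhammer_congMod X_dvd_q (show M ≤ 2 * M by omega)).mul
    (qPochhammer_congMod X_dvd_q_sq le_rfl)).mul
    (inv_qPochhammer_congMod X_dvd_q X_dvd_q_sq M.le_succ)).mul
    (inv_qPochhammer_pair_congMod X_dvd_q_sq M)).trans (CongMod.of_eq ?_)
  have h1 : ∏ i ∈ Finset.range (2 * M), (1 - -q * q ^ i) =
      ∏ i ∈ Finset.range M, ((1 - -q * (q ^ 2) ^ i) * (1 - -q ^ 2 * (q ^ 2) ^ i)) := by
    induction M with
    | zero => simp
    | succ M ih =>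
      rw [mul_add, mul_one, Finset.prod_range_succ, Finset.prod_range_succ,
        Finset.prod_range_succ, ih]
      ring
  have h2 : ∏ i ∈ Finset.range (M + 1), inv (1 - q * (q ^ 2) ^ i) =
      inv (1 - q) * ∏ i ∈ Finset.range M, inv (1 - q * (q ^ 2) ^ (i + 1)) := by
    rw [Finset.prod_range_succ', mul_comm, pow_zero, mul_one]
  rw [h1, h2, ← prod_inv_mul_prod_sq X_dvd_q_sq]
  simp only [levelProd, one_mul, Finset.prod_mul_distrib]
  ring

/-! ### Moments of the rank counts -/

theorem moment_card_filter {α : Type*} (s : Finset α) (r : α → ℤ) (k : ℕ) :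
    ∑ᶠ m : ℤ, m ^ k * ((s.filter fun a => r a = m).card : ℤ) =
      laurentMoment k (∑ a ∈ s, T (r a)) := by
  classical
  rw [map_sum, finsum_eq_sum_of_support_subset (s := s.image r)]
  · simp only [laurentMoment_T]
    rw [Finset.sum_comp (fun m : ℤ => m ^ k) r]
    exact Finset.sum_congr rfl fun m _ => by rw [nsmul_eq_mul, mul_comm]
  · intro m hm
    have h1 := right_ne_zero_of_mul (Function.mem_support.1 hm)
    obtain ⟨a, ha⟩ := Finset.card_ne_zero.1 (Nat.cast_ne_zero.1 h1)
    rw [Finset.mem_filter] at ha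
    exact Finset.mem_coe.2 (Finset.mem_image.2 ⟨a, ha⟩)

theorem NBarMoment_eq (k n : ℕ) :
    NBarMoment k n = laurentMoment k (PowerSeries.coeff n dysonRankSeries) := by
  rw [dysonRankSeries, PowerSeries.coeff_mk]
  exact moment_card_filter Finset.univ Overpartition.dysonRank k

theorem N2BarMoment_eq (k n : ℕ) :
    N2BarMoment k n = laurentMoment k (PowerSeries.coeff n m2RankOverSeries) := by
  rw [m2RankOverSeries, PowerSeries.coeff_mk]
  exact moment_card_filter Finset.univ Overpartition.m2Rank k

theorem N2Moment_eq (k n : ℕ) :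
    N2Moment k n = laurentMoment k (PowerSeries.coeff n m2RankSeries) := by
  classical
  rw [m2RankSeries, PowerSeries.coeff_mk, ← moment_card_filter, N2Moment, moment]
  refine finsum_congr fun m => ?_
  rw [N2, Finset.filter_filter]

/-- If crank minus rank is congruent to a series above `y q ^ n`, then the crank moment at `n`
exceeds the rank moment. -/
theorem laurentMoment_lt {F R D : QSeries} {n M k : ℕ} (hn : n < M) (hFR : CongMod M (F - R) D)
    (hD : PosLE (ySeries * q ^ n) D) (hk : 1 ≤ k) :
    laurentMoment (2 * k) (PowerSeries.coeff n R) <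
      laurentMoment (2 * k) (PowerSeries.coeff n F) := by
  have h := laurentMoment_coeff_pos hD (even_two_mul k) (by omega)
  rw [← hFR.coeff_eq hn, map_sub, map_sub] at h
  linarith

theorem q_sq_mem_posSeries : q ^ 2 ∈ posSeries := pow_mem q_mem_posSeries 2

/-- For `Q = q ^ 2` the summands `n = 0` and `n = 1` of the difference cover the even and the odd
exponents. -/
theorem ySeries_mul_q_pow_posLE_crankRankDiff {γ e : QSeries} (hγ : -γ ∈ posSeries)
    (he : e ∈ posSeries) {n M : ℕ} (hn : n = 2 ∨ 4 ≤ n) (hM : 1 < M) :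
    PosLE (ySeries * q ^ n) (crankRankDiff (q ^ 2) (-q) γ e M) := by
  have hβ : -(-q) ∈ posSeries := by rw [neg_neg]; exact q_mem_posSeries
  rcases Nat.even_or_odd' n with ⟨c, rfl | rfl⟩
  · have h := ySeries_mul_pow_posLE_crankRankDiff X_dvd_q_sq q_sq_mem_posSeries hβ hγ he (c - 1)
      (show 0 < M by omega)
    rwa [Nat.sub_add_cancel (by omega), ← pow_mul] at h
  · have h := ySeries_mul_q_mul_pow_posLE_crankRankDiff X_dvd_q_sq q_sq_mem_posSeries hβ hγ he
      (by rw [neg_neg]; exact PosLE.refl q) (c - 2) hM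
    rwa [Nat.sub_add_cancel (by omega), ← pow_mul, ← pow_succ'] at h

end RankCrankMoments

open RankCrankMoments in
theorem mainTheorem1 (k : ℕ) (hk : 1 ≤ k) :
    (∀ n : ℕ, n = 2 ∨ 4 ≤ n →
      RankCrankMoments.N2Moment (2 * k) n < RankCrankMoments.M2Moment (2 * k) n) ∧
    (∀ n : ℕ, 1 ≤ n →
      RankCrankMoments.NBarMoment (2 * k) n < RankCrankMoments.MBarMoment (2 * k) n) ∧
    (∀ n : ℕ, n = 2 ∨ 4 ≤ n →
      RankCrankMoments.N2BarMoment (2 * k) n < RankCrankMoments.M2BarMoment (2 * k) n) := by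
  have hq : -(-q) ∈ posSeries := by rw [neg_neg]; exact q_mem_posSeries
  have hq2 : -(-q ^ 2) ∈ posSeries := by rw [neg_neg]; exact q_sq_mem_posSeries
  have h0 : -(0 : QSeries) ∈ posSeries := by rw [neg_zero]; exact zero_mem _
  have hX : (PowerSeries.X : QSeries) ∣ -q := (dvd_neg).2 X_dvd_q
  have hX2 : (PowerSeries.X : QSeries) ∣ -q ^ 2 := (dvd_neg).2 X_dvd_q_sq
  refine ⟨fun n hn => ?_, fun n hn => ?_, fun n hn => ?_⟩
  · rw [N2Moment_eq, M2Moment, show moment M2 = moment (coeffZQ C2) from rfl,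
      moment_eq_laurentMoment]
    exact laurentMoment_lt n.lt_succ_self
      (sub_congMod_crankRankDiff X_dvd_q_sq hX (dvd_zero _) (dvd_zero _) (by ring)
        (C2_congMod _) (m2RankSeries_congMod _))
      (ySeries_mul_q_pow_posLE_crankRankDiff h0 (zero_mem _) hn (by omega)) hk
  · rw [NBarMoment_eq, MBarMoment, show moment MBar = moment (coeffZQ CBar) from rfl,
      moment_eq_laurentMoment]
    have hpos := ySeries_mul_pow_posLE_crankRankDiff (γ := 0) (e := 0) X_dvd_q q_mem_posSeries hq
      h0 (zero_mem _) (n - 1) n.succ_pos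
    rw [Nat.sub_add_cancel hn] at hpos
    exact laurentMoment_lt n.lt_succ_self
      (sub_congMod_crankRankDiff X_dvd_q hX (dvd_zero _) (dvd_zero _) (by ring)
        (CBar_congMod _) (dysonRankSeries_congMod _)) hpos hk
  · rw [N2BarMoment_eq, M2BarMoment, show moment M2Bar = moment (coeffZQ C2Bar) from rfl,
      moment_eq_laurentMoment]
    exact laurentMoment_lt n.lt_succ_self
      (sub_congMod_crankRankDiff X_dvd_q_sq hX hX2 X_dvd_q (by ring)
        (C2Bar_congMod _) (m2RankOverSeries_congMod _))
      (ySeries_mul_q_pow_posLE_crankRankDiff hq2 q_mem_posSeries hn (by omega)) hk
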